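/- **Setting.** There are $n+1$ arms $0,1,\dots,n$. A sample of arm $i$ is an independent draw from a probability distribution $\nu_i$ on $[0,1]$ with mean $\mu_i$, where $\mu_0=1$ and $\mu_i=1-(i/n)^\alpha$ for $i=1,\dots,n$, with $\alpha>0$. The best arm is $i^*=0$. Neither the means nor their order are known to the algorithm. **Median Elimination** with accuracy $\varepsilon$ and confidence $\delta'$, run on a finite nonempty set $S$ of arms. Start with $S_1=S$, and stop as soon as the current set $S_r$ has one element, which is the output. In round $r=1,2,\dots$, let $\varepsilon_r=\frac{\varepsilon}{4}\left(\frac34\right)^{r-1}$ and $\delta_r=\delta' 2^{-r}$, take $\left\lceil \frac{1}{(\varepsilon_r/2)^2}\log\frac{3}{\delta_r}\right\rceil$ new samples of each arm of $S_r$, and let $S_{r+1}$ consist of $\lceil |S_r|/2\rceil$ arms of $S_r$ with the largest averages of these samples. Ties are broken by any fixed measurable rule, which depends on $S_r$ and these averages. **PRISM** with input $\delta\in(0,1)$. Let $A_1=\{0,1,\dots,n\}$, $n_\ell=\ell 2^\ell$ and $\epsilon_\ell=\sqrt{\log(1/\delta)/2^\ell}$. In each phase $\ell=1,2,\dots$: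 1. let $i_\ell$ be the output of Median Elimination run on $A_\ell$ with accuracy $\epsilon_\ell$ and confidence $\delta^\ell$; 2. take $n_\ell$ new samples of each arm $i\in A_\ell$, and let $\widehat\mu_i(\ell)$ be their average; 3. let $A_{\ell+1}=\{i\in A_\ell:\widehat\mu_i(\ell)\ge\widehat\mu_{i_\ell}(\ell)-2\epsilon_\ell\}$. Stop when $A_\ell$ has a unique element $\widehat i$, and output $\widehat i$. **Corollary.** For every $\alpha>0$ and every $\delta\in(0,1)$ there is a constant $C>0$, depending only on $\alpha$ and $\delta$, such that for every $n\ge2$ and all distributions $\nu_0,\dots,\nu_n$ as above, with probability at least $$1-\frac{3\delta^2}{1-\delta^2}-\frac{\delta}{1-\delta}-\frac{4\delta^2}{(1-\delta^2)^2},$$ PRISM with input $\delta$ stops, outputs $\widehat i=i^*=0$, and takes in total (including the samples taken by Median Elimination) at most $$\begin{cases} C\,n & \text{if }\alpha<1/2,\\ C\,n\log^2 n & \text{if }\alpha=1/2,\\ C\,n^{2\alpha}\log n & \text{if }\alpha>1/2\end{cases}$$ samples. (The probability bound tends to $1$ as $\delta\to0$.) -/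

import Mathlib

open MeasureTheory ProbabilityTheory
open scoped ENNReal

namespace Prism

/-- The empirical average of the first `m` values of `f`. -/
noncomputable def empMean (m : ℕ) (f : ℕ → ℝ) : ℝ :=
  (∑ k ∈ Finset.range m, f k) / m

/-- The "discard the arms below the median" step of Median Elimination, with an arbitrary
(measurable) way of breaking ties: from the arms of `S` with scores `p`, the better half,
`⌈|S| / 2⌉` arms, is kept. -/
structure HalvingRule (K : Type) [DecidableEq K] where
  keep : Finset K → (K → ℝ) → Finset K
  keep_subset : ∀ S p, keep S p ⊆ S
  card_keep : ∀ S p, (keep S p).card = (S.card + 1) / 2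
  le_of_keep : ∀ S p, ∀ a ∈ keep S p, ∀ b ∈ S \ keep S p, p b ≤ p a
  measurable_keep : ∀ S T, MeasurableSet {p : K → ℝ | keep S p = T}

/-- The better half of `S` exists: ties can be broken so that the choice depends only on the order
relations between the scores. -/
theorem HalvingRule.nonempty (K : Type) [DecidableEq K] [Finite K] : Nonempty (HalvingRule K) := by
  classical
  have ex : ∀ (S : Finset K) (p : K → ℝ), ∀ m ≤ S.card, ∃ T : Finset K, T ⊆ S ∧ T.card = m ∧
      ∀ a ∈ T, ∀ b ∈ S \ T, p b ≤ p a := by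
    intro S p m
    induction m with
    | zero => exact fun _ => ⟨∅, by simp⟩
    | succ m ih =>
      intro hm
      obtain ⟨T, hTS, hTc, hT⟩ := ih (by omega)
      have hne : (S \ T).Nonempty := by
        rw [← Finset.card_pos, Finset.card_sdiff_of_subset hTS]; omega
      obtain ⟨c, hc, hmax⟩ := Finset.exists_max_image (S \ T) p hne
      have hc2 := Finset.mem_sdiff.1 hc
      refine ⟨insert c T, Finset.insert_subset hc2.1 hTS, ?_, ?_⟩
      · rw [Finset.card_insert_of_notMem hc2.2, hTc]
      · intro a ha b hb
        have hb2 : b ∈ S \ T := by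
          simp only [Finset.mem_sdiff, Finset.mem_insert, not_or] at hb ⊢
          exact ⟨hb.1, hb.2.2⟩
        rcases Finset.mem_insert.1 ha with rfl | ha
        · exact hmax b hb2
        · exact hT a ha b hb2
  let pat : (K → ℝ) → (K × K → Prop) := fun p ab => p ab.2 ≤ p ab.1
  have key : ∀ (S : Finset K) (r : K × K → Prop), ∃ T : Finset K, ∀ p, pat p = r →
      T ⊆ S ∧ T.card = (S.card + 1) / 2 ∧ ∀ a ∈ T, ∀ b ∈ S \ T, p b ≤ p a := by
    intro S r
    by_cases h : ∃ q, pat q = r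
    · obtain ⟨q, rfl⟩ := h
      obtain ⟨T, h1, h2, h3⟩ := ex S q ((S.card + 1) / 2) (by omega)
      refine ⟨T, fun p hp => ⟨h1, h2, fun a ha b hb => ?_⟩⟩
      have := congrFun hp (a, b)
      exact this.mpr (h3 a ha b hb)
    · exact ⟨∅, fun p hp => (h ⟨p, hp⟩).elim⟩
  choose F hF using key
  refine ⟨⟨fun S p => F S (pat p), fun S p => (hF S _ p rfl).1, fun S p => (hF S _ p rfl).2.1,
    fun S p => (hF S _ p rfl).2.2, fun S T => ?_⟩⟩
  have hpat : Measurable pat := by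
    refine measurable_pi_lambda _ fun ab => ?_
    exact measurableSet_setOfPred.1 (measurableSet_le (measurable_pi_apply _) (measurable_pi_apply _))
  exact hpat (Set.toFinite {r | F S r = T}).measurableSet

/-! ### Median Elimination -/

section MedianElimination

variable {K : Type} [DecidableEq K]

/-- The accuracy of a round of Median Elimination with accuracy `ε` (rounds are counted from `0`):
`ε / 4` in the first round, then multiplied by `3 / 4` from round to round. -/
noncomputable def meEps (ε : ℝ) (r : ℕ) : ℝ := ε / 4 * (3 / 4) ^ r

/-- The confidence of a round of Median Elimination with confidence `δ`:
`δ / 2` in the first round, then halved from round to round. -/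
noncomputable def meDelta (δ : ℝ) (r : ℕ) : ℝ := δ / 2 * (1 / 2) ^ r

/-- The number of samples of each surviving arm in round `r`. -/
noncomputable def meSize (ε δ : ℝ) (r : ℕ) : ℕ :=
  ⌈1 / (meEps ε r / 2) ^ 2 * Real.log (3 / meDelta δ r)⌉₊

/-- The arms that survive at the start of round `r` of Median Elimination run on `S`, when the
`k`-th sample of arm `a` in round `r` has the value `y r a k`. A single survivor is final. -/
noncomputable def meSet (rule : HalvingRule K) (ε δ : ℝ) (S : Finset K) (y : ℕ → K → ℕ → ℝ) :
    ℕ → Finset K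
  | 0 => S
  | r + 1 =>
    if (meSet rule ε δ S y r).card ≤ 1 then meSet rule ε δ S y r
    else rule.keep (meSet rule ε δ S y r) (fun a => empMean (meSize ε δ r) (y r a))

/-- The output of Median Elimination: the arm that is eventually the only survivor. -/
noncomputable def meOutput [Nonempty K] (rule : HalvingRule K) (ε δ : ℝ) (S : Finset K)
    (y : ℕ → K → ℕ → ℝ) : K :=
  Classical.epsilon fun i => ∃ r, meSet rule ε δ S y r = {i}

/-- The number of samples that Median Elimination takes: in each round that starts with at least
two survivors, each of them is sampled `meSize ε δ r` times. -/
noncomputable def meSamples (rule : HalvingRule K) (ε δ : ℝ) (S : Finset K)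
    (y : ℕ → K → ℕ → ℝ) : ℝ≥0∞ :=
  ∑' r : ℕ, if 1 < (meSet rule ε δ S y r).card
    then ((meSet rule ε δ S y r).card : ℝ≥0∞) * (meSize ε δ r : ℝ≥0∞) else 0

end MedianElimination

/-! ### PRISM -/

/-- The samples that PRISM may request: the `k`-th sample of an arm in a given round of the call of
Median Elimination in a given phase, or the `k`-th sample of an arm in the estimation step of a
given phase. Every request is a new draw, so each has a slot of its own. -/
inductive Slot (K : Type) : Type
  | elimination (phase round : ℕ) (arm : K) (k : ℕ) : Slot K
  | estimation (phase : ℕ) (arm : K) (k : ℕ) : Slot K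

/-- The arm that is sampled in a slot. -/
def Slot.arm {K : Type} : Slot K → K
  | .elimination _ _ a _ => a
  | .estimation _ a _ => a

section Algorithm

variable {K : Type} [DecidableEq K]

/-- `n_ℓ = ℓ 2^ℓ`. -/
def phaseSize (l : ℕ) : ℕ := l * 2 ^ l

/-- `ε_ℓ = √(log (1/δ) / 2^ℓ)`. -/
noncomputable def phaseEps (δ : ℝ) (l : ℕ) : ℝ := Real.sqrt (Real.log (1 / δ) / 2 ^ l)

/-- The average of the `n_ℓ` samples of arm `a` in the estimation step of phase `l`. -/
noncomputable def phaseMean (x : Slot K → ℝ) (l : ℕ) (a : K) : ℝ :=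
  empMean (phaseSize l) (fun k => x (.estimation l a k))

/-- The arm `i_ℓ`: the output of Median Elimination run on `A` in phase `l`
with accuracy `(ε_ℓ, δ ^ ℓ)`. -/
noncomputable def phaseRef [Nonempty K] (rule : HalvingRule K) (δ : ℝ) (x : Slot K → ℝ) (l : ℕ)
    (A : Finset K) : K :=
  meOutput rule (phaseEps δ l) (δ ^ l) A (fun r a k => x (.elimination l r a k))

/-- `active rule δ x j` is the set `A_{j+1}` of arms with which phase `ℓ = j + 1` of PRISM with
input `δ` starts, when the samples have the values `x`. A single arm is final. -/
noncomputable def active [Fintype K] [Nonempty K] (rule : HalvingRule K) (δ : ℝ)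
    (x : Slot K → ℝ) : ℕ → Finset K
  | 0 => Finset.univ
  | j + 1 =>
    if (active rule δ x j).card ≤ 1 then active rule δ x j
    else
      {a ∈ active rule δ x j |
        phaseMean x (j + 1) (phaseRef rule δ x (j + 1) (active rule δ x j))
          - 2 * phaseEps δ (j + 1) ≤ phaseMean x (j + 1) a}

/-- PRISM stops and outputs arm `i`. -/
def Outputs [Fintype K] [Nonempty K] (rule : HalvingRule K) (δ : ℝ) (x : Slot K → ℝ)
    (i : K) : Prop :=
  ∃ j, active rule δ x j = {i}

/-- The total number of samples that PRISM takes until it stops (`∞` if it does not stop): those of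
Median Elimination and `n_ℓ` for each active arm, over all phases that start with at least
two active arms. -/
noncomputable def samples [Fintype K] [Nonempty K] (rule : HalvingRule K) (δ : ℝ)
    (x : Slot K → ℝ) : ℝ≥0∞ :=
  ∑' j : ℕ, if 1 < (active rule δ x j).card
    then meSamples rule (phaseEps δ (j + 1)) (δ ^ (j + 1)) (active rule δ x j)
          (fun r a k => x (.elimination (j + 1) r a k))
        + ((active rule δ x j).card : ℝ≥0∞) * (phaseSize (j + 1) : ℝ≥0∞)
    else 0

end Algorithm

/-! ### The stochastic model -/

/-- `X` is a table of independent samples of arms with reward distributions `ν`: the entries are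
mutually independent, and each entry has the law of the arm that it samples. -/
structure IsSampling {K Ω : Type*} [MeasurableSpace Ω] {S : Type*} (arm : S → K)
    (P : Measure Ω) (ν : K → Measure ℝ) (X : S → Ω → ℝ) : Prop where
  measurable : ∀ s, Measurable (X s)
  law : ∀ s, P.map (X s) = ν (arm s)
  indep : iIndepFun X P

/-- The means `μ_0 = 1` and `μ_i = 1 - (i/n)^α` for `i = 1, …, n`. -/
noncomputable def alphaMean (α : ℝ) (n : ℕ) (i : Fin (n + 1)) : ℝ :=
  if i = 0 then 1 else 1 - ((i : ℕ) / (n : ℝ)) ^ α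

/-- The claimed order of growth of the number of samples. -/
noncomputable def rate (α : ℝ) (n : ℕ) : ℝ :=
  if α < 1 / 2 then (n : ℝ)
  else if α = 1 / 2 then n * Real.log n ^ 2
  else (n : ℝ) ^ (2 * α) * Real.log n

/-- The bound on the failure probability of PRISM with input `δ`. -/
noncomputable def failBound (δ : ℝ) : ℝ :=
  3 * δ ^ 2 / (1 - δ ^ 2) + δ / (1 - δ) + 4 * δ ^ 2 / (1 - δ ^ 2) ^ 2

end Prism

namespace Prism

/-! ### Independence and concentration in a table of samples -/

section Sampling

-- For `1 / 2 ≤ δ` the failure bound is at least 1 and nothing is claimed, so let `δ < 1 / 2`. Write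
-- ε for the accuracy of a phase ℓ. The phase is good if the reference arm is ε-optimal among the
-- active arms, its estimate is accurate to ε, and the best arm is not underestimated by ε. Then the
-- best arm's estimate is within 2ε of the reference's, so it survives; an arm with gap at least 5ε
-- survives only if it is overestimated by ε. Median Elimination fails with probability at most δ^ℓ,
-- and each of three Hoeffding tails has probability at most δ^(2ℓ). Summing over ℓ gives the first
-- two terms of `failBound` (`IsSampling.measure_exists_phaseBad_le`).
--
-- There is no union bound over the suboptimal arms. Instead, the samples of an arm with gap Δ split
-- into a deterministic part, from phases where Δ < 5ε may still hold, and a random part, from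
-- phases that follow an overestimation (`tsum_active_le`). The first is O(Δ⁻² (1 + log Δ⁻¹)) by
-- `earlySamples_le`; the second has expectation at most 6 by `IsSampling.lintegral_lateSamples_le`.
-- Markov's inequality for the sum of the random parts, at level 6n/η with η the third term of
-- `failBound`, costs exactly η.
--
-- Median Elimination adds only a constant factor (`exists_meSamples_le`), and the best arm is
-- charged to its surviving rivals (`samples_le`). What remains is to sum Δ⁻² (1 + log Δ⁻¹) over the
-- arms (`exists_sum_complexity_le`), which produces the three regimes. Once the cost is finite,
-- PRISM has stopped with the best arm still active.

/-- The σ-algebra generated by the entries of the table `X` with index in `U`. -/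
@[reducible]
def tableSigma {S Ω : Type*} (X : S → Ω → ℝ) (U : Set S) : MeasurableSpace Ω :=
  ⨆ s ∈ U, MeasurableSpace.comap (X s) inferInstance

theorem measurable_tableSigma {S Ω : Type*} {X : S → Ω → ℝ} {U : Set S} {s : S} (hs : s ∈ U) :
    Measurable[tableSigma X U] (X s) :=
  (comap_measurable (X s)).mono (le_iSup₂_of_le s hs le_rfl) le_rfl

variable {K Ω S : Type*} {mΩ : MeasurableSpace Ω} {arm : S → K} {P : Measure Ω}
  {ν : K → Measure ℝ} {X : S → Ω → ℝ}

theorem IsSampling.tableSigma_le (h : IsSampling arm P ν X) (U : Set S) :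
    tableSigma X U ≤ mΩ :=
  iSup₂_le fun s _ => (h.measurable s).comap_le

theorem IsSampling.indep_tableSigma (h : IsSampling arm P ν X) {U V : Set S}
    (hUV : Disjoint U V) : Indep (tableSigma X U) (tableSigma X V) P :=
  indep_iSup_of_disjoint (fun s => (h.measurable s).comap_le) h.indep.iIndep hUV

theorem IsSampling.precomp (h : IsSampling arm P ν X) {S' : Type*} {g : S' → S}
    (hg : g.Injective) : IsSampling (arm ∘ g) P ν (fun s => X (g s)) :=
  ⟨fun s => h.measurable (g s), fun s => h.law (g s), h.indep.precomp hg⟩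

/-- If each of the events `B t` is independent of the choice `A` of the index `t`, then choosing
the index at random does not make the event more likely. -/
theorem measure_mem_le_of_indep [IsProbabilityMeasure P] {T : Type*} [Finite T]
    {m₁ m₂ : MeasurableSpace Ω} (h₁ : m₁ ≤ mΩ) (hind : Indep m₁ m₂ P)
    {A : Ω → T} (hA : ∀ t, MeasurableSet[m₁] {ω | A ω = t})
    {B : T → Set Ω} (hB : ∀ t, MeasurableSet[m₂] (B t)) {p : ℝ≥0∞} (hp : ∀ t, P (B t) ≤ p) :
    P {ω | ω ∈ B (A ω)} ≤ p := by
  classical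
  have := Fintype.ofFinite T
  have hsub : {ω | ω ∈ B (A ω)} ⊆ ⋃ t ∈ (Finset.univ : Finset T), {ω | A ω = t} ∩ B t := by
    intro ω hω
    simpa using hω
  have hsum : ∑ t, P {ω | A ω = t} = 1 := by
    rw [← measure_biUnion_finset ?_ fun t _ => h₁ _ (hA t)]
    · have : (⋃ t ∈ (Finset.univ : Finset T), {ω | A ω = t}) = Set.univ := by ext; simp
      rw [this, measure_univ]
    · intro s _ t _ hst
      refine Set.disjoint_left.2 fun ω hs ht => hst ?_
      exact (show A ω = s from hs).symm.trans ht
  calc P {ω | ω ∈ B (A ω)} ≤ ∑ t, P ({ω | A ω = t} ∩ B t) :=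
        (measure_mono hsub).trans (measure_biUnion_finset_le _ _)
    _ = ∑ t, P {ω | A ω = t} * P (B t) :=
        Finset.sum_congr rfl fun t _ => (Indep_iff _ _ P).1 hind _ _ (hA t) (hB t)
    _ ≤ ∑ t, P {ω | A ω = t} * p := Finset.sum_le_sum fun t _ => by gcongr; exact hp t
    _ = p := by rw [← Finset.sum_mul, hsum, one_mul]

/-- Hoeffding's inequality for the upper tail of an empirical mean of `[0, 1]`-valued variables. -/
theorem measure_empMean_ge_le [IsProbabilityMeasure P] {Y : ℕ → Ω → ℝ}
    (hY : ∀ k, Measurable (Y k)) (hind : iIndepFun Y P) {u v : ℝ} (huv : v - u = 1)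
    (hb : ∀ k, ∀ᵐ ω ∂P, Y k ω ∈ Set.Icc u v) {c : ℝ} (hc : ∀ k, ∫ ω, Y k ω ∂P = c)
    (m : ℕ) {t : ℝ} (ht : 0 ≤ t) :
    P {ω | c + t ≤ empMean m (fun k => Y k ω)} ≤ ENNReal.ofReal (Real.exp (-2 * m * t ^ 2)) := by
  -- With no samples the right-hand side is exp 0 = 1.
  rcases Nat.eq_zero_or_pos m with rfl | hm
  · simpa using prob_le_one
  have hm' : (0 : ℝ) < m := by exact_mod_cast hm
  have hind' : iIndepFun (fun k ω => Y k ω - c) P :=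
    hind.comp (fun _ x => x - c) fun _ => measurable_id.sub_const c
  have hsub : ∀ k < m, HasSubgaussianMGF (fun ω => Y k ω - c) ((‖v - u‖₊ / 2) ^ 2) P := by
    intro k _
    have := hasSubgaussianMGF_of_mem_Icc (hY k).aemeasurable (hb k)
    rwa [hc k] at this
  have key := HasSubgaussianMGF.measure_sum_range_ge_le_of_iIndepFun hind' hsub
    (ε := m * t) (by positivity)
  rw [huv] at key
  have hset : {ω | c + t ≤ empMean m (fun k => Y k ω)}
      = {ω | m * t ≤ ∑ k ∈ Finset.range m, (Y k ω - c)} := by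
    ext ω
    simp only [Set.mem_ofPred_eq, empMean, Finset.sum_sub_distrib, Finset.sum_const,
      Finset.card_range, nsmul_eq_mul]
    rw [le_div_iff₀ hm']
    constructor <;> intro h <;> nlinarith
  rw [hset, ← ENNReal.ofReal_toReal (measure_ne_top P _)]
  refine ENNReal.ofReal_le_ofReal (key.trans (le_of_eq ?_))
  congr 1
  simp
  field_simp

theorem IsSampling.ae_mem (h : IsSampling arm P ν X)
    (hν : ∀ i, ∀ᵐ t ∂(ν i), t ∈ Set.Icc (0 : ℝ) 1) (s : S) :
    ∀ᵐ ω ∂P, X s ω ∈ Set.Icc (0 : ℝ) 1 :=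
  ae_of_ae_map (h.measurable s).aemeasurable (by rw [h.law s]; exact hν _)

theorem IsSampling.integral_eq (h : IsSampling arm P ν X) {μ : K → ℝ}
    (hμ : ∀ i, ∫ t, t ∂(ν i) = μ i) (s : S) : ∫ ω, X s ω ∂P = μ (arm s) := by
  rw [← hμ, ← h.law s,
    integral_map (f := fun t => t) (h.measurable s).aemeasurable aestronglyMeasurable_id]

theorem IsSampling.measure_empMean_ge_le [IsProbabilityMeasure P] (h : IsSampling arm P ν X)
    (hν : ∀ i, ∀ᵐ t ∂(ν i), t ∈ Set.Icc (0 : ℝ) 1) {μ : K → ℝ} (hμ : ∀ i, ∫ t, t ∂(ν i) = μ i)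
    {s : ℕ → S} (hs : s.Injective) {a : K} (ha : ∀ k, arm (s k) = a)
    (m : ℕ) {t : ℝ} (ht : 0 ≤ t) :
    P {ω | μ a + t ≤ empMean m (fun k => X (s k) ω)}
      ≤ ENNReal.ofReal (Real.exp (-2 * m * t ^ 2)) :=
  Prism.measure_empMean_ge_le (fun k => h.measurable (s k)) (h.indep.precomp hs)
    (u := 0) (v := 1) (by norm_num) (fun k => h.ae_mem hν (s k))
    (fun k => by rw [h.integral_eq hμ, ha]) m ht

theorem IsSampling.measure_empMean_le_le [IsProbabilityMeasure P] (h : IsSampling arm P ν X)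
    (hν : ∀ i, ∀ᵐ t ∂(ν i), t ∈ Set.Icc (0 : ℝ) 1) {μ : K → ℝ} (hμ : ∀ i, ∫ t, t ∂(ν i) = μ i)
    {s : ℕ → S} (hs : s.Injective) {a : K} (ha : ∀ k, arm (s k) = a)
    (m : ℕ) {t : ℝ} (ht : 0 ≤ t) :
    P {ω | empMean m (fun k => X (s k) ω) ≤ μ a - t}
      ≤ ENNReal.ofReal (Real.exp (-2 * m * t ^ 2)) := by
  -- The lower tail is the upper tail of the negated samples, which lie in [-1, 0]; hence the
  -- general interval of length 1 in the upper bound.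
  have := Prism.measure_empMean_ge_le (P := P) (Y := fun k ω => -X (s k) ω)
    (fun k => (h.measurable (s k)).neg)
    ((h.indep.precomp hs).comp (fun _ x => -x) fun _ => measurable_neg)
    (u := -1) (v := 0) (by norm_num)
    (fun k => by
      filter_upwards [h.ae_mem hν (s k)] with ω hω
      exact ⟨neg_le_neg hω.2, neg_nonpos.2 hω.1⟩)
    (c := -μ a) (fun k => by rw [integral_neg, h.integral_eq hμ, ha]) m ht
  refine le_trans (le_of_eq ?_) this
  congr 1
  ext ω
  simp only [Set.mem_ofPred_eq, empMean, Finset.sum_neg_distrib, neg_div]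
  constructor <;> intro h <;> linarith

theorem measurable_empMean {mΩ : MeasurableSpace Ω} {m : ℕ} {f : ℕ → Ω → ℝ}
    (hf : ∀ k, Measurable (f k)) : Measurable fun ω => empMean m (fun k => f k ω) := by
  unfold empMean
  exact (Finset.measurable_sum _ fun k _ => hf k).div_const _

end Sampling

/-! ### Median Elimination -/

section MedianElimination

variable {K : Type} [DecidableEq K] (rule : HalvingRule K)

theorem HalvingRule.keep_nonempty {S : Finset K} (hS : S.Nonempty) (p : K → ℝ) :
    (rule.keep S p).Nonempty := by
  rw [← Finset.card_pos, rule.card_keep]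
  have := hS.card_pos
  omega

theorem meSet_nonempty {ε δ : ℝ} {S : Finset K} (hS : S.Nonempty) (y : ℕ → K → ℕ → ℝ) (r : ℕ) :
    (meSet rule ε δ S y r).Nonempty := by
  induction r with
  | zero => exact hS
  | succ r ih =>
    rw [meSet]
    split_ifs
    · exact ih
    · exact rule.keep_nonempty ih _

/-- Because of the ceiling it is the cardinality minus one, not the cardinality, that is at least
halved in each round. -/
theorem two_pow_mul_card_meSet_sub_one_le (ε δ : ℝ) (S : Finset K) (y : ℕ → K → ℕ → ℝ) (r : ℕ) :
    2 ^ r * ((meSet rule ε δ S y r).card - 1) ≤ S.card - 1 := by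
  induction r with
  | zero => simp [meSet]
  | succ r ih =>
    rw [meSet]
    split_ifs with h
    · have : (meSet rule ε δ S y r).card - 1 = 0 := by omega
      simp [this]
    · refine le_trans ?_ ih
      rw [rule.card_keep, pow_succ, mul_assoc]
      gcongr
      omega

theorem exists_meSet_eq_singleton (ε δ : ℝ) {S : Finset K} (hS : S.Nonempty)
    (y : ℕ → K → ℕ → ℝ) : ∃ i r, meSet rule ε δ S y r = {i} := by
  have h := two_pow_mul_card_meSet_sub_one_le rule ε δ S y S.card
  have hne := (meSet_nonempty rule (ε := ε) (δ := δ) hS y S.card).card_pos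
  have hlt : S.card < 2 ^ S.card := Nat.lt_two_pow_self
  have h1 : (meSet rule ε δ S y S.card).card = 1 := by
    by_contra hc
    have : 1 ≤ (meSet rule ε δ S y S.card).card - 1 := by omega
    have := Nat.mul_le_mul_left (2 ^ S.card) this
    omega
  obtain ⟨i, hi⟩ := Finset.card_eq_one.1 h1
  exact ⟨i, _, hi⟩

theorem meOutput_spec [Nonempty K] (ε δ : ℝ) {S : Finset K} (hS : S.Nonempty)
    (y : ℕ → K → ℕ → ℝ) : ∃ r, meSet rule ε δ S y r = {meOutput rule ε δ S y} :=
  Classical.epsilon_spec (p := fun i => ∃ r, meSet rule ε δ S y r = {i})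
    (exists_meSet_eq_singleton rule ε δ hS y)

/-- Only rounds before `r` are assumed measurable, so the lemma also applies to the σ-algebra of
those rounds alone; this gives independence from round `r`. -/
theorem measurableSet_meSet {Ω : Type*} [MeasurableSpace Ω] [Finite K] (ε δ : ℝ) (S : Finset K)
    {y : ℕ → K → ℕ → Ω → ℝ} (r : ℕ) (hy : ∀ q < r, ∀ a k, Measurable (y q a k)) (T : Finset K) :
    MeasurableSet {ω | meSet rule ε δ S (fun q a k => y q a k ω) r = T} := by
  induction r generalizing T with
  | zero => simp [meSet]
  | succ r ih =>
    have ih' := ih fun q hq => hy q (hq.trans (Nat.lt_succ_self r))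
    have heq : {ω | meSet rule ε δ S (fun q a k => y q a k ω) (r + 1) = T}
        = ⋃ R : Finset K, {ω | meSet rule ε δ S (fun q a k => y q a k ω) r = R} ∩
          {ω | (if R.card ≤ 1 then R
            else rule.keep R (fun a => empMean (meSize ε δ r) (fun k => y r a k ω))) = T} := by
      ext ω
      simp [meSet]
    rw [heq]
    refine MeasurableSet.iUnion fun R => (ih' R).inter ?_
    split_ifs
    · exact MeasurableSet.const _
    · have hm : Measurable fun ω => fun a => empMean (meSize ε δ r) (fun k => y r a k ω) :=
        measurable_pi_lambda _ fun a => measurable_empMean (hy r (Nat.lt_succ_self r) a)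
      exact hm (rule.measurable_keep R T)

theorem measurableSet_meOutput {Ω : Type*} [MeasurableSpace Ω] [Finite K] [Nonempty K] (ε δ : ℝ)
    (S : Finset K) {y : ℕ → K → ℕ → Ω → ℝ} (hy : ∀ r a k, Measurable (y r a k)) (i : K) :
    MeasurableSet {ω | meOutput rule ε δ S (fun q a k => y q a k ω) = i} := by
  have hQ : Measurable fun (ω : Ω) (j : K) =>
      ∃ r, meSet rule ε δ S (fun q a k => y q a k ω) r = {j} := by
    refine measurable_pi_lambda _ fun j => measurableSet_setOfPred.1 ?_
    rw [Set.ofPred_exists]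
    exact MeasurableSet.iUnion fun r => measurableSet_meSet rule ε δ S r (fun q _ => hy q) {j}
  -- `Classical.epsilon` is a function on the finite space of predicates on `K`, where every set is
  -- measurable.
  exact hQ (Set.toFinite {Q : K → Prop | Classical.epsilon Q = i}).measurableSet

/-- One halving step loses more than `e` with probability at most `d`, when each score is accurate
to within `e / 2` on either side with probability at least `1 - d / 3`. -/
theorem measure_keep_bad_le {Ω : Type*} [MeasurableSpace Ω] {P : Measure Ω} {S : Finset K}
    (hS : S.Nonempty) {μ : K → ℝ} {e : ℝ} (he : 0 ≤ e) {d : ℝ≥0∞} {p : Ω → K → ℝ}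
    (hp : ∀ a, Measurable fun ω => p ω a)
    (hlow : ∀ a, P {ω | p ω a ≤ μ a - e / 2} ≤ d / 3)
    (hup : ∀ a, P {ω | μ a + e / 2 ≤ p ω a} ≤ d / 3) :
    P {ω | ∃ a ∈ S, ∀ b ∈ rule.keep S (p ω), μ b < μ a - e} ≤ d := by
  obtain ⟨a, haS, ha⟩ := S.exists_max_image μ hS
  -- `N` counts the overestimated arms. If every kept arm is bad while the optimal `a` is not
  -- underestimated, then `a` was dropped and all kept arms, at least half of `S`, are
  -- overestimated. By Markov this has probability at most 2d/3.
  let N : Ω → ℝ≥0∞ := fun ω => ∑ b ∈ S, {ω | μ b + e / 2 ≤ p ω b}.indicator 1 ω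
  have hmeas : ∀ b, MeasurableSet {ω | μ b + e / 2 ≤ p ω b} := fun b =>
    measurableSet_le measurable_const (hp b)
  have hN : Measurable N := Finset.measurable_sum _ fun b _ => measurable_one.indicator (hmeas b)
  have hint : ∫⁻ ω, N ω ∂P ≤ S.card * (d / 3) := by
    rw [lintegral_finsetSum _ fun b _ => measurable_one.indicator (hmeas b)]
    calc _ = ∑ b ∈ S, P {ω | μ b + e / 2 ≤ p ω b} :=
          Finset.sum_congr rfl fun b _ => lintegral_indicator_one (hmeas b)
      _ ≤ ∑ b ∈ S, d / 3 := Finset.sum_le_sum fun b _ => hup b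
      _ = _ := by simp
  have hc0 : (S.card : ℝ≥0∞) / 2 ≠ 0 := by
    have := hS.card_pos.ne'
    simp [ENNReal.div_eq_zero_iff, this]
  have hct : (S.card : ℝ≥0∞) / 2 ≠ ∞ := by finiteness
  have hmarkov : P {ω | (S.card : ℝ≥0∞) / 2 ≤ N ω} ≤ 2 * (d / 3) := by
    refine (meas_ge_le_lintegral_div hN.aemeasurable hc0 hct).trans ?_
    refine ENNReal.div_le_of_le_mul (hint.trans (le_of_eq ?_))
    rw [mul_comm 2, mul_assoc, ENNReal.mul_div_cancel (by norm_num) (by norm_num), mul_comm]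
  have hsub : {ω | ∃ a ∈ S, ∀ b ∈ rule.keep S (p ω), μ b < μ a - e}
      ⊆ {ω | p ω a ≤ μ a - e / 2} ∪ {ω | (S.card : ℝ≥0∞) / 2 ≤ N ω} := by
    rintro ω ⟨c, hcS, hc⟩
    by_contra hcon
    simp only [Set.mem_union, Set.mem_ofPred_eq, not_or, not_le] at hcon
    obtain ⟨h1, h2⟩ := hcon
    have hbad : ∀ b ∈ rule.keep S (p ω), μ b < μ a - e := fun b hb =>
      (hc b hb).trans_le (sub_le_sub_right (ha c hcS) e)
    have hak : a ∉ rule.keep S (p ω) := fun h => by linarith [hbad a h]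
    have hover : ∀ b ∈ rule.keep S (p ω), μ b + e / 2 ≤ p ω b := fun b hb => by
      have := rule.le_of_keep S (p ω) b hb a (Finset.mem_sdiff.2 ⟨haS, hak⟩)
      linarith [hbad b hb]
    have hcard : ((rule.keep S (p ω)).card : ℝ≥0∞) ≤ N ω := by
      calc ((rule.keep S (p ω)).card : ℝ≥0∞)
          = ∑ b ∈ rule.keep S (p ω), {ω | μ b + e / 2 ≤ p ω b}.indicator 1 ω := by
            rw [Finset.card_eq_sum_ones, Nat.cast_sum]
            refine Finset.sum_congr rfl fun b hb => ?_
            rw [Set.indicator_of_mem (show ω ∈ {ω | μ b + e / 2 ≤ p ω b} from hover b hb)]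
            simp
        _ ≤ N ω := Finset.sum_le_sum_of_subset (rule.keep_subset S _)
    rw [rule.card_keep] at hcard
    refine (h2.trans_le' (le_trans ?_ hcard)).false
    refine ENNReal.div_le_of_le_mul ?_
    have : S.card ≤ (S.card + 1) / 2 * 2 := by omega
    exact_mod_cast this
  calc _ ≤ d / 3 + 2 * (d / 3) :=
        (measure_mono hsub).trans ((measure_union_le _ _).trans (add_le_add (hlow a) hmarkov))
    _ = d := by
      rw [← one_add_mul, show (1 + 2 : ℝ≥0∞) = 3 by norm_num]
      exact ENNReal.mul_div_cancel (by norm_num) (by norm_num)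

theorem tsum_meDelta {δ : ℝ} (hδ : 0 ≤ δ) :
    ∑' r, ENNReal.ofReal (meDelta δ r) = ENNReal.ofReal δ := by
  have hs : HasSum (meDelta δ) δ := by
    have := hasSum_geometric_two.mul_left (δ / 2)
    rw [div_mul_cancel₀ δ two_ne_zero] at this
    exact this
  rw [← ENNReal.ofReal_tsum_of_nonneg (fun r => by unfold meDelta; positivity) hs.summable,
    hs.tsum_eq]

theorem sum_meEps_le {ε : ℝ} (hε : 0 ≤ ε) (r : ℕ) : ∑ q ∈ Finset.range r, meEps ε q ≤ ε := by
  have hs : HasSum (meEps ε) ε := by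
    have := (hasSum_geometric_of_lt_one (r := 3 / 4) (by norm_num) (by norm_num)).mul_left (ε / 4)
    rw [show ε / 4 * (1 - 3 / 4)⁻¹ = ε by norm_num] at this
    exact this
  exact sum_le_hasSum _ (fun q _ => by unfold meEps; positivity) hs

/-- The sample size makes the exponent at most minus the logarithm of 3/δ_r; Hoeffding's factor 2 is
not needed. -/
theorem exp_meSize_le {ε δ : ℝ} (hε : 0 < ε) (hδ : 0 < δ) (hδ1 : δ ≤ 1) (r : ℕ) :
    Real.exp (-2 * meSize ε δ r * (meEps ε r / 2) ^ 2) ≤ meDelta δ r / 3 := by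
  have hD : 0 < meDelta δ r := by unfold meDelta; positivity
  have hE : 0 < meEps ε r := by unfold meEps; positivity
  have hD1 : meDelta δ r ≤ 3 := by
    unfold meDelta
    have : ((1 : ℝ) / 2) ^ r ≤ 1 := pow_le_one₀ (by norm_num) (by norm_num)
    nlinarith
  have hlog : 0 ≤ Real.log (3 / meDelta δ r) := Real.log_nonneg (by rwa [le_div_iff₀ hD, one_mul])
  have hsize : 1 / (meEps ε r / 2) ^ 2 * Real.log (3 / meDelta δ r) ≤ meSize ε δ r := Nat.le_ceil _
  have h2 : Real.log (3 / meDelta δ r) ≤ meSize ε δ r * (meEps ε r / 2) ^ 2 := by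
    rw [one_div, inv_mul_le_iff₀ (by positivity)] at hsize
    linarith
  rw [← Real.le_log_iff_exp_le (by positivity), ← inv_div 3, Real.log_inv]
  nlinarith

/-- Median Elimination returns an `ε`-optimal arm with probability at least `1 - δ`. -/
theorem IsSampling.measure_meOutput_bad_le [Finite K] [Nonempty K] {Ω : Type*} [MeasurableSpace Ω]
    {P : Measure Ω} [IsProbabilityMeasure P] {ν : K → Measure ℝ} {Y : ℕ × K × ℕ → Ω → ℝ}
    (h : IsSampling (fun s : ℕ × K × ℕ => s.2.1) P ν Y)
    (hν : ∀ i, ∀ᵐ t ∂(ν i), t ∈ Set.Icc (0 : ℝ) 1) {μ : K → ℝ} (hμ : ∀ i, ∫ t, t ∂(ν i) = μ i)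
    {ε δ : ℝ} (hε : 0 < ε) (hδ : 0 < δ) (hδ1 : δ ≤ 1) (S : Finset K) :
    P {ω | ∃ a ∈ S, μ (meOutput rule ε δ S (fun r a k => Y (r, a, k) ω)) < μ a - ε}
      ≤ ENNReal.ofReal δ := by
  let R : Ω → ℕ → Finset K := fun ω => meSet rule ε δ S (fun r a k => Y (r, a, k) ω)
  let sc : ℕ → Ω → K → ℝ := fun r ω a => empMean (meSize ε δ r) (fun k => Y (r, a, k) ω)
  let B : ℕ → Finset K → Set Ω := fun r T =>
    {ω | ∃ a ∈ T, ∀ b ∈ rule.keep T (sc r ω), μ b < μ a - meEps ε r}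
  have hE : ∀ r, 0 < meEps ε r := fun r => by unfold meEps; positivity
  have hBle : ∀ r T, P (B r T) ≤ ENNReal.ofReal (meDelta δ r) := by
    intro r T
    rcases T.eq_empty_or_nonempty with rfl | hT
    · simp [B]
    have hexp : ENNReal.ofReal (Real.exp (-2 * meSize ε δ r * (meEps ε r / 2) ^ 2))
        ≤ ENNReal.ofReal (meDelta δ r) / 3 := by
      refine (ENNReal.ofReal_le_ofReal (exp_meSize_le hε hδ hδ1 r)).trans (le_of_eq ?_)
      rw [ENNReal.ofReal_div_of_pos (by norm_num)]
      simp
    have hinj : ∀ a : K, Function.Injective fun k : ℕ => (r, a, k) := fun a k k' hk => by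
      simpa using hk
    refine measure_keep_bad_le rule hT (hE r).le (p := sc r)
      (fun a => measurable_empMean fun k => h.measurable _) (fun a => ?_) (fun a => ?_)
    · exact (h.measure_empMean_le_le hν hμ (hinj a) (fun _ => rfl) _ (half_pos (hE r)).le).trans
        hexp
    · exact (h.measure_empMean_ge_le hν hμ (hinj a) (fun _ => rfl) _ (half_pos (hE r)).le).trans
        hexp
  have hround : ∀ r, P {ω | ω ∈ B r (R ω r)} ≤ ENNReal.ofReal (meDelta δ r) := by
    intro r
    -- The survivors at the start of round `r` are determined by earlier rounds, and the scores of
    -- round `r` are fresh.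
    have hdisj : Disjoint {s : ℕ × K × ℕ | s.1 < r} {s | s.1 = r} :=
      Set.disjoint_left.2 fun s hs hs' => (ne_of_lt hs) hs'
    refine measure_mem_le_of_indep (h.tableSigma_le _) (h.indep_tableSigma hdisj)
      (A := fun ω => R ω r) (B := B r) ?_ ?_ (hBle r)
    · intro T
      exact @measurableSet_meSet K _ rule Ω (tableSigma Y _) _ ε δ S
        (fun q a k ω => Y (q, a, k) ω) r (fun q hq a k => measurable_tableSigma hq) T
    · intro T
      let _ : MeasurableSpace Ω := tableSigma Y {s : ℕ × K × ℕ | s.1 = r}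
      have hm : Measurable (sc r) := measurable_pi_lambda _ fun a => measurable_empMean
        fun k => measurable_tableSigma (show (r, a, k).1 = r from rfl)
      have heq : B r T = ⋃ U ∈ {U : Finset K | ∃ a ∈ T, ∀ b ∈ U, μ b < μ a - meEps ε r},
          sc r ⁻¹' {p | rule.keep T p = U} := by
        ext ω; simp [B]
      rw [heq]
      exact MeasurableSet.biUnion (Set.to_countable _) fun U _ => hm (rule.measurable_keep T U)
  have hsub : {ω | ∃ a ∈ S, μ (meOutput rule ε δ S (fun r a k => Y (r, a, k) ω)) < μ a - ε}
      ⊆ ⋃ r, {ω | ω ∈ B r (R ω r)} := by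
    rintro ω ⟨a, haS, ha⟩
    by_contra hcon
    simp only [Set.mem_iUnion, not_exists] at hcon
    -- Without a bad round, the best surviving mean drops by at most `meEps ε q` in round `q`, and
    -- these losses sum to at most `ε`.
    have hchain : ∀ r, ∃ b ∈ R ω r, μ a - ∑ q ∈ Finset.range r, meEps ε q ≤ μ b := by
      intro r
      induction r with
      | zero => exact ⟨a, haS, by simp⟩
      | succ r ih =>
        obtain ⟨b, hb, hab⟩ := ih
        rw [Finset.sum_range_succ]
        by_cases hcard : (R ω r).card ≤ 1
        · refine ⟨b, ?_, by linarith [hE r]⟩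
          have : R ω (r + 1) = R ω r := by simp only [R] at hcard ⊢; rw [meSet, if_pos hcard]
          rwa [this]
        · have hnot := hcon r
          simp only [B, Set.mem_ofPred_eq, not_exists, not_and, not_forall, not_lt] at hnot
          obtain ⟨c, hc, hbc⟩ := hnot b hb
          refine ⟨c, ?_, by linarith⟩
          have : R ω (r + 1) = rule.keep (R ω r) (sc r ω) := by
            simp only [R] at hcard ⊢; rw [meSet, if_neg hcard]
          rwa [this]
    obtain ⟨r, hr⟩ := meOutput_spec rule ε δ ⟨a, haS⟩ (fun r a k => Y (r, a, k) ω)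
    obtain ⟨b, hb, hab⟩ := hchain r
    have hb' : b = meOutput rule ε δ S (fun r a k => Y (r, a, k) ω) := by
      simp only [R] at hb
      rw [hr] at hb
      exact Finset.mem_singleton.1 hb
    rw [← hb'] at ha
    linarith [sum_meEps_le hε.le r]
  calc _ ≤ ∑' r, P {ω | ω ∈ B r (R ω r)} := (measure_mono hsub).trans (measure_iUnion_le _)
    _ ≤ ∑' r, ENNReal.ofReal (meDelta δ r) := ENNReal.tsum_le_tsum hround
    _ = ENNReal.ofReal δ := tsum_meDelta hδ.le

end MedianElimination

-- The cost of Median Elimination in a phase of PRISM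

section Cost

theorem phaseEps_sq {δ : ℝ} (hδ : 0 < δ) (hδ1 : δ < 1) (l : ℕ) :
    phaseEps δ l ^ 2 = Real.log (1 / δ) / 2 ^ l := by
  have := Real.log_pos (one_lt_one_div hδ hδ1)
  exact Real.sq_sqrt (by positivity)

theorem phaseEps_pos {δ : ℝ} (hδ : 0 < δ) (hδ1 : δ < 1) (l : ℕ) : 0 < phaseEps δ l := by
  have := Real.log_pos (one_lt_one_div hδ hδ1)
  exact Real.sqrt_pos.2 (by positivity)

/-- The inverse square accuracy contributes `2 ^ l`, and the confidence `δ ^ l` contributes a factor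
`l` through the logarithm; together they match `phaseSize l`. The factor `(16 / 9) ^ r` is the
inverse square of `(3 / 4) ^ r`. -/
theorem meSize_phase_le {δ : ℝ} (hδ : 0 < δ) (hδ1 : δ < 1) {l : ℕ} (hl : 0 < l) (r : ℕ) :
    (meSize (phaseEps δ l) (δ ^ l) r : ℝ)
      ≤ (64 * (5 + Real.log (1 / δ)) / Real.log (1 / δ) + 1) * phaseSize l
        * ((r + 1) * (16 / 9) ^ r) := by
  set L := Real.log (1 / δ) with hL
  have hL0 : 0 < L := Real.log_pos (one_lt_one_div hδ hδ1)
  have hl1 : (1 : ℝ) ≤ l := by exact_mod_cast hl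
  have hsq : 1 / (meEps (phaseEps δ l) r / 2) ^ 2 = 64 / L * 2 ^ l * (16 / 9) ^ r := by
    have h1 : (meEps (phaseEps δ l) r / 2) ^ 2 = L / 2 ^ l / 64 * (9 / 16) ^ r := by
      rw [hL, ← phaseEps_sq hδ hδ1, meEps, show (9 / 16 : ℝ) = (3 / 4) ^ 2 by norm_num,
        ← pow_mul, mul_comm 2 r, pow_mul]
      ring
    rw [h1, show (16 / 9 : ℝ) = (9 / 16)⁻¹ by norm_num, inv_pow]
    field_simp
  have hlog : Real.log (3 / meDelta (δ ^ l) r) ≤ l * (r + 1) * (5 + L) := by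
    have h1 : 3 / meDelta (δ ^ l) r = 6 * 2 ^ r * (1 / δ) ^ l := by
      rw [meDelta, one_div_pow, one_div_pow]
      field_simp
      norm_num
    have h6 : Real.log 6 ≤ 5 := by
      have := Real.log_le_sub_one_of_pos (show (0 : ℝ) < 6 by norm_num)
      linarith
    have h2 : Real.log 2 ≤ 1 := by
      have := Real.log_le_sub_one_of_pos (show (0 : ℝ) < 2 by norm_num)
      linarith
    rw [h1, Real.log_mul (by positivity) (by positivity), Real.log_mul (by norm_num)
      (by positivity), Real.log_pow, Real.log_pow, ← hL]
    have h3 : (r : ℝ) * Real.log 2 ≤ r := mul_le_of_le_one_right (Nat.cast_nonneg r) h2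
    have h4 : 0 ≤ (l - 1 : ℝ) * (r * 5 + 5) := mul_nonneg (by linarith) (by positivity)
    have h5 : 0 ≤ (l : ℝ) * r * L := by positivity
    nlinarith [Nat.cast_nonneg (α := ℝ) r]
  -- This absorbs the 1 lost to the ceiling in `meSize`.
  have hone : (1 : ℝ) ≤ phaseSize l * ((r + 1) * (16 / 9) ^ r) := by
    have h1 : (1 : ℝ) ≤ phaseSize l := by
      exact_mod_cast Nat.one_le_iff_ne_zero.2 (by simp [phaseSize, hl.ne'])
    have h2 : (1 : ℝ) ≤ (16 / 9) ^ r := one_le_pow₀ (by norm_num)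
    have h3 : (1 : ℝ) ≤ r + 1 := by linarith [Nat.cast_nonneg (α := ℝ) r]
    exact one_le_mul_of_one_le_of_one_le h1 (one_le_mul_of_one_le_of_one_le h3 h2)
  have hnn : 0 ≤ 1 / (meEps (phaseEps δ l) r / 2) ^ 2 * Real.log (3 / meDelta (δ ^ l) r) := by
    refine mul_nonneg (by positivity) (Real.log_nonneg ?_)
    have h1 : δ ^ l ≤ 1 := pow_le_one₀ hδ.le hδ1.le
    have h2 : ((1 : ℝ) / 2) ^ r ≤ 1 := pow_le_one₀ (by norm_num) (by norm_num)
    have h3 : 0 < δ ^ l := by positivity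
    rw [meDelta, le_div_iff₀ (by positivity), one_mul]
    nlinarith
  calc (meSize (phaseEps δ l) (δ ^ l) r : ℝ)
      ≤ 1 / (meEps (phaseEps δ l) r / 2) ^ 2 * Real.log (3 / meDelta (δ ^ l) r) + 1 :=
        (Nat.ceil_lt_add_one hnn).le
    _ ≤ 64 / L * 2 ^ l * (16 / 9) ^ r * (l * (r + 1) * (5 + L)) + 1 := by
        rw [hsq]; gcongr
    _ = 64 * (5 + L) / L * (phaseSize l * ((r + 1) * (16 / 9) ^ r)) + 1 := by
        simp only [phaseSize]; push_cast; ring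
    _ ≤ 64 * (5 + L) / L * (phaseSize l * ((r + 1) * (16 / 9) ^ r))
          + phaseSize l * ((r + 1) * (16 / 9) ^ r) := by linarith
    _ = _ := by ring

/-- With the parameters of phase `l`, Median Elimination takes at most a constant times
`phaseSize l` samples per arm. -/
theorem exists_meSamples_le {δ : ℝ} (hδ : 0 < δ) (hδ1 : δ < 1) :
    ∃ κ : ℝ, 0 ≤ κ ∧ ∀ {K : Type} [DecidableEq K] (rule : HalvingRule K) {l : ℕ}, 0 < l →
      ∀ (S : Finset K) (y : ℕ → K → ℕ → ℝ),
        meSamples rule (phaseEps δ l) (δ ^ l) S y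
          ≤ ENNReal.ofReal κ * (S.card * phaseSize l : ℝ≥0∞) := by
  set κ₀ := 64 * (5 + Real.log (1 / δ)) / Real.log (1 / δ) + 1 with hκ₀
  have hL0 : 0 < Real.log (1 / δ) := Real.log_pos (one_lt_one_div hδ hδ1)
  have hκ : 0 ≤ κ₀ := by positivity
  -- Halving the survivors turns the growth rate 16/9 per arm into 8/9 in total, which is summable.
  -- The factor 2 comes from card ≤ 2 (card - 1) for at least two survivors.
  let g : ℕ → ℝ := fun r => 2 * κ₀ * ((r + 1) * (8 / 9) ^ r)
  have hg : ∀ r, 0 ≤ g r := fun r => by positivity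
  have hsum : Summable g := by
    refine Summable.mul_left _ ?_
    simp only [add_mul, one_mul]
    refine Summable.add ?_ (summable_geometric_of_lt_one (by norm_num) (by norm_num))
    simpa using summable_pow_mul_geometric_of_norm_lt_one 1 (r := (8 / 9 : ℝ))
      (by rw [Real.norm_eq_abs, abs_of_pos] <;> norm_num)
  refine ⟨∑' r, g r, tsum_nonneg hg, fun {K} _ rule {l} hl S y => ?_⟩
  rw [ENNReal.ofReal_tsum_of_nonneg hg hsum, ← ENNReal.tsum_mul_right]
  refine ENNReal.tsum_le_tsum fun r => ?_
  split_ifs with hc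
  · have hcard : 2 ^ r * (meSet rule (phaseEps δ l) (δ ^ l) S y r).card ≤ 2 * S.card := by
      have h1 := two_pow_mul_card_meSet_sub_one_le rule (phaseEps δ l) (δ ^ l) S y r
      have h2 : 2 ^ r * (meSet rule (phaseEps δ l) (δ ^ l) S y r).card
          ≤ 2 ^ r * (2 * ((meSet rule (phaseEps δ l) (δ ^ l) S y r).card - 1)) := by
        gcongr; omega
      have h3 : 2 ^ r * (2 * ((meSet rule (phaseEps δ l) (δ ^ l) S y r).card - 1))
        = 2 * (2 ^ r * ((meSet rule (phaseEps δ l) (δ ^ l) S y r).card - 1)) := by ring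
      omega
    have hcard' : ((meSet rule (phaseEps δ l) (δ ^ l) S y r).card : ℝ)
        ≤ 2 * S.card * (1 / 2) ^ r := by
      rw [one_div_pow, mul_one_div, le_div_iff₀ (by positivity), mul_comm]
      exact_mod_cast hcard
    rw [← ENNReal.ofReal_natCast, ← ENNReal.ofReal_natCast, ← ENNReal.ofReal_natCast,
      ← ENNReal.ofReal_natCast, ← ENNReal.ofReal_mul (by positivity),
      ← ENNReal.ofReal_mul (by positivity), ← ENNReal.ofReal_mul (hg r)]
    refine ENNReal.ofReal_le_ofReal ?_
    calc _ ≤ (2 * S.card * (1 / 2) ^ r) * (κ₀ * phaseSize l * ((r + 1) * (16 / 9) ^ r)) := by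
          gcongr; exact meSize_phase_le hδ hδ1 hl r
      _ = 2 * κ₀ * ((r + 1) * ((1 / 2) * (16 / 9)) ^ r) * (S.card * phaseSize l) := by
          rw [mul_pow]; ring
      _ = _ := by simp only [g]; norm_num
  · exact zero_le

end Cost

/-! ### PRISM -/

/-- The phase to which a slot belongs. -/
def Slot.phase {K : Type} : Slot K → ℕ
  | .elimination l _ _ _ => l
  | .estimation l _ _ => l

-- Dependence of the active set on past phases only

section Measurability

theorem measurable_phaseMean {K : Type} {Ω : Type*} [MeasurableSpace Ω] {X : Slot K → Ω → ℝ}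
    {l : ℕ} {a : K} (hX : ∀ k, Measurable (X (.estimation l a k))) :
    Measurable fun ω => phaseMean (fun s => X s ω) l a :=
  measurable_empMean hX

variable {K : Type} [DecidableEq K] (rule : HalvingRule K) {Ω : Type*} [MeasurableSpace Ω]
  {X : Slot K → Ω → ℝ}

theorem measurableSet_phaseRef [Finite K] [Nonempty K] (δ : ℝ) {l : ℕ}
    (hX : ∀ r a k, Measurable (X (.elimination l r a k))) (A : Finset K) (i : K) :
    MeasurableSet {ω | phaseRef rule δ (fun s => X s ω) l A = i} :=
  measurableSet_meOutput rule _ _ A (y := fun r a k => X (.elimination l r a k)) hX i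

theorem measurableSet_active [Fintype K] [Nonempty K] (δ : ℝ) (j : ℕ)
    (hX : ∀ s : Slot K, s.phase ≤ j → Measurable (X s)) (T : Finset K) :
    MeasurableSet {ω | active rule δ (fun s => X s ω) j = T} := by
  induction j generalizing T with
  | zero => simp [active]
  | succ j ih =>
    have ih' := ih fun s hs => hX s (hs.trans (Nat.le_succ j))
    have heq : {ω | active rule δ (fun s => X s ω) (j + 1) = T}
        = ⋃ R : Finset K, ⋃ i : K, {ω | active rule δ (fun s => X s ω) j = R} ∩
          ({ω | phaseRef rule δ (fun s => X s ω) (j + 1) R = i} ∩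
          {ω | (if R.card ≤ 1 then R else
            {a ∈ R | phaseMean (fun s => X s ω) (j + 1) i - 2 * phaseEps δ (j + 1)
              ≤ phaseMean (fun s => X s ω) (j + 1) a}) = T}) := by
      ext ω
      simp [active]
    rw [heq]
    refine MeasurableSet.iUnion fun R => MeasurableSet.iUnion fun i => (ih' R).inter
      ((measurableSet_phaseRef rule δ (fun r a k => hX _ le_rfl) R i).inter ?_)
    split_ifs
    · simp
    · simp only [Finset.ext_iff, Finset.mem_filter]
      rw [Set.ofPred_forall]
      refine MeasurableSet.iInter fun a => ?_
      have hm : MeasurableSet {ω | phaseMean (fun s => X s ω) (j + 1) i - 2 * phaseEps δ (j + 1)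
          ≤ phaseMean (fun s => X s ω) (j + 1) a} :=
        measurableSet_le ((measurable_phaseMean fun k => hX _ le_rfl).sub_const _)
          (measurable_phaseMean fun k => hX _ le_rfl)
      by_cases ha : a ∈ R <;> by_cases haT : a ∈ T <;> simp only [ha, haT, true_and, false_and,
        iff_true, iff_false]
      · exact hm
      · exact hm.compl
      · simp
      · simp

end Measurability

-- Deterministic analysis of PRISM on good samples

section Algorithm

variable {K : Type} [DecidableEq K] [Fintype K] [Nonempty K] (rule : HalvingRule K)

/-- The reference arm of the phase that starts with `active rule δ x j` is not nearly optimal among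
the active arms. -/
def RefBad (δ : ℝ) (μ : K → ℝ) (x : Slot K → ℝ) (j : ℕ) : Prop :=
  ∃ a ∈ active rule δ x j,
    μ (phaseRef rule δ x (j + 1) (active rule δ x j)) < μ a - phaseEps δ (j + 1)

/-- The estimate of the mean of arm `i` in phase `j + 1` is off by `phaseEps δ (j + 1)`. -/
def EstBad (δ : ℝ) (μ : K → ℝ) (x : Slot K → ℝ) (j : ℕ) (i : K) : Prop :=
  phaseMean x (j + 1) i ≤ μ i - phaseEps δ (j + 1) ∨
    μ i + phaseEps δ (j + 1) ≤ phaseMean x (j + 1) i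

/-- Phase `j + 1` goes wrong for the reference arm or for the best arm `b`. -/
def PhaseBad (δ : ℝ) (μ : K → ℝ) (b : K) (x : Slot K → ℝ) (j : ℕ) : Prop :=
  RefBad rule δ μ x j ∨ EstBad δ μ x j (phaseRef rule δ x (j + 1) (active rule δ x j)) ∨
    phaseMean x (j + 1) b ≤ μ b - phaseEps δ (j + 1)

variable {rule} {δ : ℝ} {μ : K → ℝ} {b : K} {x : Slot K → ℝ}

/-- The best arm's estimate exceeds its mean minus ε, and the reference's estimate is below the
reference's mean plus ε. The best mean is the larger one, so the slack of 2ε in the elimination rule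
suffices. -/
theorem mem_active_of_not_phaseBad (hb : ∀ i, μ i ≤ μ b)
    (hx : ∀ j, ¬ PhaseBad rule δ μ b x j) (j : ℕ) : b ∈ active rule δ x j := by
  induction j with
  | zero => simp [active]
  | succ j ih =>
    rw [active]
    split_ifs with hc
    · exact ih
    · have h := hx j
      simp only [PhaseBad, EstBad, not_or, not_le] at h
      rw [Finset.mem_filter]
      refine ⟨ih, ?_⟩
      linarith [h.2.1.2, h.2.2, hb (phaseRef rule δ x (j + 1) (active rule δ x j))]

theorem active_succ_subset (j : ℕ) : active rule δ x (j + 1) ⊆ active rule δ x j := by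
  rw [active]
  split_ifs
  · exact subset_rfl
  · exact Finset.filter_subset _ _

/-- When the reference arm and the best arm behave, a suboptimal arm survives only if its mean is
overestimated. -/
theorem overestimated_of_mem_active_succ (hb : ∀ i, μ i ≤ μ b)
    (hx : ∀ j, ¬ PhaseBad rule δ μ b x j) {j : ℕ} (hc : 1 < (active rule δ x j).card) {i : K}
    (hi : i ∈ active rule δ x (j + 1)) (hgap : 5 * phaseEps δ (j + 1) ≤ μ b - μ i) :
    μ i + phaseEps δ (j + 1) ≤ phaseMean x (j + 1) i := by
  rw [active, if_neg (not_le.2 hc), Finset.mem_filter] at hi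
  have h := hx j
  simp only [PhaseBad, EstBad, RefBad, not_or, not_le, not_exists, not_and, not_lt] at h
  linarith [h.1 b (mem_active_of_not_phaseBad hb hx j), h.2.1.1, hi.2]

/-- The number of samples that an arm with gap `Δ` receives in the phases in which it may still be
indistinguishable from the best arm. -/
noncomputable def earlySamples (δ Δ : ℝ) : ℝ≥0∞ :=
  ∑' j : ℕ, if j = 0 ∨ Δ < 5 * phaseEps δ j then (phaseSize (j + 1) : ℝ≥0∞) else 0

/-- The number of samples that arm `i` receives in the phases that follow an overestimation of its
mean. -/
noncomputable def lateSamples (δ : ℝ) (μ : K → ℝ) (i : K) (x : Slot K → ℝ) : ℝ≥0∞ :=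
  ∑' j : ℕ, {x : Slot K → ℝ | μ i + phaseEps δ (j + 1) ≤ phaseMean x (j + 1) i}.indicator
    (fun _ => (phaseSize (j + 2) : ℝ≥0∞)) x

/-- An arm is sampled in phase `j + 2` only if it survived phase `j + 1`: either its gap was then
below the threshold, or it was overestimated. Hence the shift of indices in both sums; the first
phase is always charged to `earlySamples`. -/
theorem tsum_active_le (hb : ∀ i, μ i ≤ μ b) (hx : ∀ j, ¬ PhaseBad rule δ μ b x j) (i : K) :
    ∑' j : ℕ, (if 1 < (active rule δ x j).card ∧ i ∈ active rule δ x j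
      then (phaseSize (j + 1) : ℝ≥0∞) else 0)
      ≤ earlySamples δ (μ b - μ i) + lateSamples δ μ i x := by
  rw [earlySamples, lateSamples, tsum_eq_zero_add' ENNReal.summable,
    tsum_eq_zero_add' (f := fun j : ℕ => if j = 0 ∨ μ b - μ i < 5 * phaseEps δ j
      then (phaseSize (j + 1) : ℝ≥0∞) else 0) ENNReal.summable, add_assoc,
    ← ENNReal.tsum_add]
  refine add_le_add ?_ (ENNReal.tsum_le_tsum fun j => ?_)
  · rw [if_pos (Or.inl rfl)]
    split_ifs <;> simp
  · by_cases h : 1 < (active rule δ x (j + 1)).card ∧ i ∈ active rule δ x (j + 1)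
    · rw [if_pos h]
      by_cases hgap : 5 * phaseEps δ (j + 1) ≤ μ b - μ i
      · have hc := h.1.trans_le (Finset.card_le_card (active_succ_subset j))
        rw [Set.indicator_of_mem]
        · exact le_add_self
        · exact overestimated_of_mem_active_succ hb hx hc h.2 hgap
      · rw [if_pos (Or.inr (not_le.1 hgap))]
        exact le_self_add
    · rw [if_neg h]
      exact zero_le

/-- While at least two arms are active, their number is at most twice the number of active arms
other than `b`. The best arm has no gap to bound its own cost, so it is charged to the others at the
price of a factor 2. -/
theorem samples_le (hb : ∀ i, μ i ≤ μ b) (hx : ∀ j, ¬ PhaseBad rule δ μ b x j) {κ : ℝ≥0∞}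
    (hκ : ∀ l, 0 < l → ∀ (S : Finset K) (y : ℕ → K → ℕ → ℝ),
      meSamples rule (phaseEps δ l) (δ ^ l) S y ≤ κ * (S.card * phaseSize l : ℝ≥0∞)) :
    samples rule δ x ≤ 2 * (κ + 1) *
      ∑ i ∈ Finset.univ.erase b, (earlySamples δ (μ b - μ i) + lateSamples δ μ i x) := by
  have hterm : ∀ j : ℕ, (if 1 < (active rule δ x j).card
      then meSamples rule (phaseEps δ (j + 1)) (δ ^ (j + 1)) (active rule δ x j)
          (fun r a k => x (.elimination (j + 1) r a k))
        + ((active rule δ x j).card : ℝ≥0∞) * (phaseSize (j + 1) : ℝ≥0∞)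
      else 0) ≤ 2 * (κ + 1) * ∑ i ∈ Finset.univ.erase b,
        (if 1 < (active rule δ x j).card ∧ i ∈ active rule δ x j
          then (phaseSize (j + 1) : ℝ≥0∞) else 0) := by
    intro j
    split_ifs with hc
    · have hsum : ∑ i ∈ Finset.univ.erase b,
          (if 1 < (active rule δ x j).card ∧ i ∈ active rule δ x j
            then (phaseSize (j + 1) : ℝ≥0∞) else 0)
          = ((active rule δ x j).erase b).card * (phaseSize (j + 1) : ℝ≥0∞) := by
        simp only [hc, true_and]
        rw [← Finset.sum_filter, Finset.sum_const, nsmul_eq_mul]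
        congr 3
        ext i
        simp
      have hcard : ((active rule δ x j).card : ℝ≥0∞) ≤ 2 * ((active rule δ x j).erase b).card := by
        rw [Finset.card_erase_of_mem (mem_active_of_not_phaseBad hb hx j)]
        exact_mod_cast (by omega : (active rule δ x j).card ≤ 2 * ((active rule δ x j).card - 1))
      rw [hsum]
      calc _ ≤ κ * ((active rule δ x j).card * phaseSize (j + 1) : ℝ≥0∞)
            + (active rule δ x j).card * phaseSize (j + 1) := by
            gcongr; exact hκ _ (Nat.succ_pos j) _ _
        _ = (κ + 1) * ((active rule δ x j).card * phaseSize (j + 1)) := by ring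
        _ ≤ (κ + 1) * ((2 * ((active rule δ x j).erase b).card) * phaseSize (j + 1)) := by
            gcongr
        _ = _ := by ring
    · exact zero_le
  calc samples rule δ x ≤ _ := ENNReal.tsum_le_tsum hterm
    _ ≤ _ := by
      rw [ENNReal.tsum_mul_left, Summable.tsum_finsetSum fun i _ => ENNReal.summable]
      gcongr with i _
      exact tsum_active_le hb hx i

/-- If PRISM stops taking samples and the best arm is never discarded, then it is the output. -/
theorem outputs_of_samples_ne_top (hmem : ∀ j, b ∈ active rule δ x j)
    (hfin : samples rule δ x ≠ ∞) : Outputs rule δ x b := by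
  by_contra hcon
  refine hfin ?_
  have hcard : ∀ j, 1 < (active rule δ x j).card := by
    intro j
    by_contra hc
    refine hcon ⟨j, ?_⟩
    exact Finset.eq_singleton_iff_unique_mem.2
      ⟨hmem j, fun i hi => Finset.card_le_one.1 (not_lt.1 hc) i hi b (hmem j)⟩
  -- If no active set were a singleton, every phase would cost at least one sample.
  rw [samples, eq_top_iff, ← ENNReal.tsum_const_eq_top_of_ne_zero (α := ℕ) one_ne_zero]
  refine ENNReal.tsum_le_tsum fun j => ?_
  rw [if_pos (hcard j)]
  refine le_add_of_le_right ?_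
  have h1 : 1 ≤ (active rule δ x j).card * phaseSize (j + 1) :=
    Nat.mul_pos (by have := hcard j; omega) (by simp [phaseSize])
  exact_mod_cast h1

end Algorithm

-- Tail bounds for the estimates and the expected late samples

section Tails

variable {K : Type} {Ω : Type*} [MeasurableSpace Ω] {P : Measure Ω} {ν : K → Measure ℝ}
  {X : Slot K → Ω → ℝ} {δ : ℝ} {μ : K → ℝ}

theorem exp_phaseSize (hδ : 0 < δ) (hδ1 : δ < 1) (l : ℕ) :
    Real.exp (-2 * phaseSize l * phaseEps δ l ^ 2) = (δ ^ 2) ^ l := by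
  rw [phaseEps_sq hδ hδ1, phaseSize]
  have : -2 * ((l * 2 ^ l : ℕ) : ℝ) * (Real.log (1 / δ) / 2 ^ l)
      = ((2 * l : ℕ) : ℝ) * Real.log δ := by
    rw [one_div, Real.log_inv]
    push_cast
    field_simp
  rw [this, Real.exp_nat_mul, Real.exp_log hδ, pow_mul]

theorem IsSampling.measure_phaseMean_ge_le [IsProbabilityMeasure P] (h : IsSampling Slot.arm P ν X)
    (hν : ∀ i, ∀ᵐ t ∂(ν i), t ∈ Set.Icc (0 : ℝ) 1) (hμ : ∀ i, ∫ t, t ∂(ν i) = μ i)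
    (hδ : 0 < δ) (hδ1 : δ < 1) (l : ℕ) (i : K) :
    P {ω | μ i + phaseEps δ l ≤ phaseMean (fun s => X s ω) l i} ≤ ENNReal.ofReal ((δ ^ 2) ^ l) := by
  rw [← exp_phaseSize hδ hδ1]
  exact h.measure_empMean_ge_le hν hμ (s := fun k => Slot.estimation l i k)
    (fun k k' hk => by simpa using hk) (fun _ => rfl) _ (phaseEps_pos hδ hδ1 l).le

theorem IsSampling.measure_phaseMean_le_le [IsProbabilityMeasure P] (h : IsSampling Slot.arm P ν X)
    (hν : ∀ i, ∀ᵐ t ∂(ν i), t ∈ Set.Icc (0 : ℝ) 1) (hμ : ∀ i, ∫ t, t ∂(ν i) = μ i)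
    (hδ : 0 < δ) (hδ1 : δ < 1) (l : ℕ) (i : K) :
    P {ω | phaseMean (fun s => X s ω) l i ≤ μ i - phaseEps δ l} ≤ ENNReal.ofReal ((δ ^ 2) ^ l) := by
  rw [← exp_phaseSize hδ hδ1]
  exact h.measure_empMean_le_le hν hμ (s := fun k => Slot.estimation l i k)
    (fun k k' hk => by simpa using hk) (fun _ => rfl) _ (phaseEps_pos hδ hδ1 l).le

theorem IsSampling.measurable_lateSamples (h : IsSampling Slot.arm P ν X) (i : K) :
    Measurable fun ω => lateSamples δ μ i (fun s => X s ω) :=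
  Measurable.tsum fun j => (measurable_const.indicator (measurableSet_le measurable_const
    (measurable_phaseMean fun _ => h.measurable _)) :
    Measurable ({ω | μ i + phaseEps δ (j + 1) ≤ phaseMean (fun s => X s ω) (j + 1) i}.indicator
      fun _ => (phaseSize (j + 2) : ℝ≥0∞)))

/-- Overestimation in phase `j + 1` has probability at most `(δ ^ 2) ^ (j + 1)`, which for `δ ≤ 1 /
2` beats the doubling of `phaseSize (j + 2)`. The expected terms are at most (j + 2) / 2^j, with sum
2 + 4. -/
theorem IsSampling.lintegral_lateSamples_le [IsProbabilityMeasure P] (h : IsSampling Slot.arm P ν X)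
    (hν : ∀ i, ∀ᵐ t ∂(ν i), t ∈ Set.Icc (0 : ℝ) 1) (hμ : ∀ i, ∫ t, t ∂(ν i) = μ i)
    (hδ : 0 < δ) (hδ2 : δ ≤ 1 / 2) (i : K) :
    ∫⁻ ω, lateSamples δ μ i (fun s => X s ω) ∂P ≤ 6 := by
  have hm : ∀ j : ℕ, MeasurableSet
      {ω | μ i + phaseEps δ (j + 1) ≤ phaseMean (fun s => X s ω) (j + 1) i} := fun j =>
    measurableSet_le measurable_const (measurable_phaseMean fun _ => h.measurable _)
  have hterm : ∀ j : ℕ, ∫⁻ ω, {ω | μ i + phaseEps δ (j + 1)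
      ≤ phaseMean (fun s => X s ω) (j + 1) i}.indicator (fun _ => (phaseSize (j + 2) : ℝ≥0∞)) ω ∂P
      ≤ ENNReal.ofReal (j * (1 / 2) ^ j + 2 * (1 / 2) ^ j) := by
    intro j
    calc _ = phaseSize (j + 2) * P {ω | μ i + phaseEps δ (j + 1)
          ≤ phaseMean (fun s => X s ω) (j + 1) i} := lintegral_indicator_const (hm j) _
      _ ≤ phaseSize (j + 2) * ENNReal.ofReal ((δ ^ 2) ^ (j + 1)) := by
          gcongr; exact h.measure_phaseMean_ge_le hν hμ hδ (by linarith) _ i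
      _ = ENNReal.ofReal (phaseSize (j + 2) * (δ ^ 2) ^ (j + 1)) := by
          rw [ENNReal.ofReal_mul (by positivity), ENNReal.ofReal_natCast]
      _ ≤ _ := by
          refine ENNReal.ofReal_le_ofReal ?_
          have h1 : (δ ^ 2) ^ (j + 1) ≤ (((1 : ℝ) / 2) ^ 2) ^ (j + 1) := by gcongr
          calc (phaseSize (j + 2) : ℝ) * (δ ^ 2) ^ (j + 1)
              ≤ phaseSize (j + 2) * (((1 : ℝ) / 2) ^ 2) ^ (j + 1) := by gcongr
            _ = ((j : ℝ) + 2) * (2 ^ 2 * (1 / 2) ^ 2) * (2 * (1 / 2) ^ 2) ^ j := by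
                simp only [phaseSize, mul_pow]; push_cast; ring
            _ = (j : ℝ) * (1 / 2) ^ j + 2 * (1 / 2) ^ j := by rw [← add_mul]; norm_num
  have hsum : HasSum (fun j : ℕ => (j : ℝ) * (1 / 2) ^ j + 2 * (1 / 2) ^ j) 6 := by
    have h1 := hasSum_coe_mul_geometric_of_norm_lt_one (r := (1 / 2 : ℝ)) (by norm_num)
    have h2 := hasSum_geometric_two.mul_left 2
    have h3 := h1.add h2
    rwa [show (1 / 2 / (1 - 1 / 2) ^ 2 + 2 * 2 : ℝ) = 6 by norm_num] at h3
  change ∫⁻ ω, ∑' j : ℕ, {ω | μ i + phaseEps δ (j + 1)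
    ≤ phaseMean (fun s => X s ω) (j + 1) i}.indicator (fun _ => (phaseSize (j + 2) : ℝ≥0∞)) ω ∂P ≤ 6
  rw [lintegral_tsum fun j => (measurable_const.indicator (hm j)).aemeasurable]
  calc _ ≤ ∑' j : ℕ, ENNReal.ofReal (j * (1 / 2) ^ j + 2 * (1 / 2) ^ j) :=
        ENNReal.tsum_le_tsum hterm
    _ = 6 := by
        rw [← ENNReal.ofReal_tsum_of_nonneg (fun j => by positivity) hsum.summable, hsum.tsum_eq]
        norm_num

end Tails

-- Probability that some phase goes wrong

section Probability

variable {K : Type} [DecidableEq K] [Fintype K] [Nonempty K] (rule : HalvingRule K)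
  {Ω : Type*} [MeasurableSpace Ω] {P : Measure Ω} [IsProbabilityMeasure P] {ν : K → Measure ℝ}
  {X : Slot K → Ω → ℝ} {δ : ℝ} {μ : K → ℝ}

theorem IsSampling.measure_refBad_le (h : IsSampling Slot.arm P ν X)
    (hν : ∀ i, ∀ᵐ t ∂(ν i), t ∈ Set.Icc (0 : ℝ) 1) (hμ : ∀ i, ∫ t, t ∂(ν i) = μ i)
    (hδ : 0 < δ) (hδ1 : δ < 1) (j : ℕ) :
    P {ω | RefBad rule δ μ (fun s => X s ω) j} ≤ ENNReal.ofReal (δ ^ (j + 1)) := by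
  let U : Set (Slot K) := {s | s.phase ≤ j}
  let V : Set (Slot K) := {s | s.phase = j + 1}
  have hdisj : Disjoint U V := Set.disjoint_left.2 fun s (hs : s.phase ≤ j)
    (hs' : s.phase = j + 1) => by omega
  refine measure_mem_le_of_indep (h.tableSigma_le _) (h.indep_tableSigma hdisj)
    (A := fun ω => active rule δ (fun s => X s ω) j)
    (B := fun A => {ω | ∃ a ∈ A,
      μ (phaseRef rule δ (fun s => X s ω) (j + 1) A) < μ a - phaseEps δ (j + 1)}) ?_ ?_ ?_
  · exact fun A => @measurableSet_active K _ rule Ω (tableSigma X U) X _ _ δ j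
      (fun s hs => measurable_tableSigma hs) A
  · intro A
    have heq : {ω | ∃ a ∈ A,
        μ (phaseRef rule δ (fun s => X s ω) (j + 1) A) < μ a - phaseEps δ (j + 1)}
        = ⋃ i ∈ {i | ∃ a ∈ A, μ i < μ a - phaseEps δ (j + 1)},
          {ω | phaseRef rule δ (fun s => X s ω) (j + 1) A = i} := by
      ext ω; simp
    rw [heq]
    exact MeasurableSet.biUnion (Set.to_countable _) fun i _ =>
      @measurableSet_phaseRef K _ rule Ω (tableSigma X V) X _ _ δ (j + 1)
        (fun r a k => measurable_tableSigma (show Slot.phase _ = j + 1 from rfl)) A i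
  · intro A
    -- The slots of this one call of Median Elimination form a sampling table of their own.
    have hg : Function.Injective
        fun s : ℕ × K × ℕ => Slot.elimination (j + 1) s.1 s.2.1 s.2.2 := by
      rintro ⟨r, a, k⟩ ⟨r', a', k'⟩ hk
      simpa using hk
    exact (h.precomp hg).measure_meOutput_bad_le rule hν hμ (phaseEps_pos hδ hδ1 _)
      (pow_pos hδ _) (pow_le_one₀ hδ.le hδ1.le) A

/-- The reference arm is random, but it is chosen without the estimation samples of its phase. So it
obeys the two-sided bound of a fixed arm, with no union over arms. -/
theorem IsSampling.measure_estBad_phaseRef_le (h : IsSampling Slot.arm P ν X)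
    (hν : ∀ i, ∀ᵐ t ∂(ν i), t ∈ Set.Icc (0 : ℝ) 1) (hμ : ∀ i, ∫ t, t ∂(ν i) = μ i)
    (hδ : 0 < δ) (hδ1 : δ < 1) (j : ℕ) :
    P {ω | EstBad δ μ (fun s => X s ω) j (phaseRef rule δ (fun s => X s ω) (j + 1)
      (active rule δ (fun s => X s ω) j))} ≤ 2 * ENNReal.ofReal ((δ ^ 2) ^ (j + 1)) := by
  let V : Set (Slot K) := {s | ∃ a k, s = .estimation (j + 1) a k}
  let U : Set (Slot K) := Vᶜ
  have hU : ∀ r a k, Slot.elimination (j + 1) r a k ∈ U := by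
    rintro r a k ⟨a', k', hk⟩
    simp at hk
  have hU' : ∀ s : Slot K, s.phase ≤ j → s ∈ U := by
    rintro _ hs ⟨a', k', rfl⟩
    simp [Slot.phase] at hs
  refine measure_mem_le_of_indep (h.tableSigma_le _) (h.indep_tableSigma (U := U) (V := V)
      disjoint_compl_left)
    (A := fun ω => phaseRef rule δ (fun s => X s ω) (j + 1) (active rule δ (fun s => X s ω) j))
    (B := fun i => {ω | EstBad δ μ (fun s => X s ω) j i}) ?_ ?_ ?_
  · intro i
    have heq : {ω | phaseRef rule δ (fun s => X s ω) (j + 1)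
        (active rule δ (fun s => X s ω) j) = i}
        = ⋃ A, {ω | active rule δ (fun s => X s ω) j = A} ∩
          {ω | phaseRef rule δ (fun s => X s ω) (j + 1) A = i} := by
      ext ω; simp
    rw [heq]
    exact MeasurableSet.iUnion fun A => MeasurableSet.inter
      (@measurableSet_active K _ rule Ω (tableSigma X U) X _ _ δ j
        (fun s hs => measurable_tableSigma (hU' s hs)) A)
      (@measurableSet_phaseRef K _ rule Ω (tableSigma X U) X _ _ δ (j + 1)
        (fun r a k => measurable_tableSigma (hU r a k)) A i)
  · intro i
    have hm : Measurable[tableSigma X V] fun ω => phaseMean (fun s => X s ω) (j + 1) i :=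
      @measurable_phaseMean K Ω (tableSigma X V) X (j + 1) i
        fun k => measurable_tableSigma ⟨i, k, rfl⟩
    let _ : MeasurableSpace Ω := tableSigma X V
    exact (measurableSet_le hm measurable_const).union (measurableSet_le measurable_const hm)
  · intro i
    rw [two_mul]
    exact (measure_union_le _ _).trans (add_le_add (h.measure_phaseMean_le_le hν hμ hδ hδ1 _ i)
      (h.measure_phaseMean_ge_le hν hμ hδ hδ1 _ i))

theorem IsSampling.measure_exists_phaseBad_le (h : IsSampling Slot.arm P ν X)
    (hν : ∀ i, ∀ᵐ t ∂(ν i), t ∈ Set.Icc (0 : ℝ) 1) (hμ : ∀ i, ∫ t, t ∂(ν i) = μ i)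
    (hδ : 0 < δ) (hδ1 : δ < 1) (b : K) :
    P {ω | ∃ j, PhaseBad rule δ μ b (fun s => X s ω) j}
      ≤ ENNReal.ofReal (3 * δ ^ 2 / (1 - δ ^ 2) + δ / (1 - δ)) := by
  have hphase : ∀ j, P {ω | PhaseBad rule δ μ b (fun s => X s ω) j}
      ≤ ENNReal.ofReal (3 * (δ ^ 2) ^ (j + 1) + δ ^ (j + 1)) := by
    intro j
    calc _ ≤ ENNReal.ofReal (δ ^ (j + 1)) + (2 * ENNReal.ofReal ((δ ^ 2) ^ (j + 1))
            + ENNReal.ofReal ((δ ^ 2) ^ (j + 1))) :=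
          (measure_union_le _ _).trans (add_le_add (h.measure_refBad_le rule hν hμ hδ hδ1 j)
            ((measure_union_le _ _).trans (add_le_add
              (h.measure_estBad_phaseRef_le rule hν hμ hδ hδ1 j)
              (h.measure_phaseMean_le_le hν hμ hδ hδ1 _ b))))
      _ = _ := by
          rw [ENNReal.ofReal_add (by positivity) (by positivity),
            ENNReal.ofReal_mul (by norm_num), ENNReal.ofReal_ofNat]
          ring
  have hsum : HasSum (fun j : ℕ => 3 * (δ ^ 2) ^ (j + 1) + δ ^ (j + 1))
      (3 * δ ^ 2 / (1 - δ ^ 2) + δ / (1 - δ)) := by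
    have h1 := (hasSum_geometric_of_lt_one (sq_nonneg δ) (by nlinarith)).mul_left (3 * δ ^ 2)
    have h2 := (hasSum_geometric_of_lt_one hδ.le hδ1).mul_left δ
    simpa only [pow_succ', div_eq_mul_inv, mul_assoc] using h1.add h2
  rw [Set.ofPred_exists, ← hsum.tsum_eq,
    ENNReal.ofReal_tsum_of_nonneg (fun j => by positivity) hsum.summable]
  exact (measure_iUnion_le _).trans (ENNReal.tsum_le_tsum hphase)

end Probability

/-! ### The order of growth -/

section Growth

theorem sum_range_phaseSize_le (m : ℕ) :
    ∑ j ∈ Finset.range m, phaseSize (j + 1) ≤ m * 2 ^ (m + 1) := by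
  induction m with
  | zero => simp
  | succ m ih =>
    rw [Finset.sum_range_succ]
    refine (Nat.add_le_add_right ih _).trans ?_
    simp only [phaseSize]
    have : m * 2 ^ (m + 1) ≤ (m + 1) * 2 ^ (m + 1) := by gcongr; omega
    calc _ ≤ (m + 1) * 2 ^ (m + 1) + (m + 1) * 2 ^ (m + 1) := by gcongr
      _ = _ := by ring

/-- The condition Δ < 5ε_j means 2^j < 25 L / Δ², with L the logarithm of 1/δ. The phase sizes up to
that index sum to a constant times the last one, which is of order 2^N (N + 1) with 2^N of order
Δ⁻². -/
theorem earlySamples_le {δ : ℝ} (hδ : 0 < δ) (hδ1 : δ < 1) {Δ : ℝ} (hΔ : 0 < Δ) (hΔ1 : Δ ≤ 1) :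
    earlySamples δ Δ ≤ ENNReal.ofReal (4 * (1 + 25 * Real.log (1 / δ))
      * (5 + 50 * Real.log (1 / δ)) * ((Δ ^ 2)⁻¹ * (1 + Real.log Δ⁻¹))) := by
  set L := Real.log (1 / δ) with hL
  have hL0 : 0 < L := Real.log_pos (one_lt_one_div hδ hδ1)
  have hlogΔ : 0 ≤ Real.log Δ⁻¹ := Real.log_nonneg ((one_le_inv₀ hΔ).2 hΔ1)
  set A := (1 + 25 * L) * (Δ ^ 2)⁻¹ with hA
  have hΔinv : 1 ≤ (Δ ^ 2)⁻¹ := (one_le_inv₀ (by positivity)).2 (pow_le_one₀ hΔ.le hΔ1)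
  have hA1 : 1 ≤ A := one_le_mul_of_one_le_of_one_le (by linarith) hΔinv
  -- The extra 1 in `A` ensures `1 ≤ A`, so that an exponent `N` with 2^N ≤ A < 2^(N+1) exists; all
  -- terms with `j > N` vanish.
  obtain ⟨N, hN, hN'⟩ := exists_nat_pow_near hA1 one_lt_two
  have hNlog : (N : ℝ) ≤ 50 * L + 4 * Real.log Δ⁻¹ := by
    have h1 := Real.log_le_log (by positivity) hN
    rw [Real.log_pow, hA, Real.log_mul (by positivity) (by positivity), ← inv_pow,
      Real.log_pow] at h1
    have h2 := Real.log_two_gt_d9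
    have h3 := Real.log_le_sub_one_of_pos (show (0 : ℝ) < 1 + 25 * L by positivity)
    have h4 : (N : ℝ) * (1 / 2) ≤ N * Real.log 2 := by gcongr; linarith
    push_cast at h1
    linarith
  have hle : earlySamples δ Δ ≤ ∑ j ∈ Finset.range (N + 1), (phaseSize (j + 1) : ℝ≥0∞) := by
    rw [earlySamples, tsum_eq_sum (s := Finset.range (N + 1))]
    · refine Finset.sum_le_sum fun j _ => ?_
      split_ifs
      · exact le_rfl
      · exact zero_le
    · intro j hj
      rw [Finset.mem_range, not_lt] at hj
      refine if_neg fun hcon => ?_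
      rcases hcon with rfl | hcon
      · omega
      · have h1 : Δ ^ 2 < 25 * (L / 2 ^ j) := by
          rw [hL, ← phaseEps_sq hδ hδ1]
          calc Δ ^ 2 < (5 * phaseEps δ j) ^ 2 := by gcongr
            _ = _ := by ring
        have h2 : (2 : ℝ) ^ (N + 1) ≤ 2 ^ j := pow_le_pow_right₀ one_le_two hj
        have h3 : A * Δ ^ 2 = 1 + 25 * L := by rw [hA]; field_simp
        have h4 : Δ ^ 2 * 2 ^ j < 25 * L := by
          rw [← mul_div_assoc, lt_div_iff₀ (by positivity)] at h1
          exact h1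
        have h5 : Δ ^ 2 * A < Δ ^ 2 * 2 ^ j := by
          gcongr
          exact hN'.trans_le h2
        linarith
  refine hle.trans ?_
  rw [← Nat.cast_sum, ← ENNReal.ofReal_natCast]
  refine ENNReal.ofReal_le_ofReal ?_
  calc ((∑ j ∈ Finset.range (N + 1), phaseSize (j + 1) : ℕ) : ℝ)
      ≤ ((N + 1) * 2 ^ (N + 1 + 1) : ℕ) := by exact_mod_cast sum_range_phaseSize_le (N + 1)
    _ = 4 * (2 ^ N * (N + 1)) := by push_cast; ring
    _ ≤ 4 * (A * (50 * L + 4 * Real.log Δ⁻¹ + 1)) := by gcongr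
    _ ≤ 4 * (A * ((5 + 50 * L) * (1 + Real.log Δ⁻¹))) := by gcongr; nlinarith
    _ = _ := by rw [hA]; ring

/-- The sum of the inverse powers `i ^ (-β)`, for an exponent `β < 1`. -/
theorem sum_range_rpow_neg_le {β : ℝ} (hβ0 : 0 ≤ β) (hβ : β < 1) (n : ℕ) :
    ∑ i ∈ Finset.range n, ((i + 1 : ℕ) : ℝ) ^ (-β) ≤ (n : ℝ) ^ (1 - β) / (1 - β) := by
  have hβ' : 0 < 1 - β := by linarith
  induction n with
  | zero => simp [Real.zero_rpow hβ'.ne']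
  | succ n ih =>
    rw [Finset.sum_range_succ]
    have hn : (0 : ℝ) < (n + 1 : ℕ) := by positivity
    have hn1 : (1 : ℝ) ≤ (n + 1 : ℕ) := by exact_mod_cast Nat.succ_pos n
    -- Bernoulli's inequality for the concave power 1 - β bounds each summand by a difference of
    -- consecutive values of x^(1-β) / (1-β), so the sum telescopes.
    have hb := rpow_one_add_le_one_add_mul_self (s := -(1 / ((n + 1 : ℕ) : ℝ)))
      (by rw [neg_le_neg_iff, div_le_one hn]; exact hn1) hβ'.le (by linarith)
    have hsplit : (n : ℝ) = (n + 1 : ℕ) * (1 + -(1 / ((n + 1 : ℕ) : ℝ))) := by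
      field_simp; push_cast; ring
    have hkey : (n : ℝ) ^ (1 - β)
        ≤ ((n + 1 : ℕ) : ℝ) ^ (1 - β) - (1 - β) * ((n + 1 : ℕ) : ℝ) ^ (-β) := by
      have hpos : (0 : ℝ) ≤ 1 + -(1 / ((n + 1 : ℕ) : ℝ)) := by
        rw [← sub_eq_add_neg, sub_nonneg, div_le_one hn]; exact hn1
      have hone : ((n + 1 : ℕ) : ℝ) ^ (1 - β) = (n + 1 : ℕ) * ((n + 1 : ℕ) : ℝ) ^ (-β) := by
        rw [sub_eq_add_neg, Real.rpow_add hn, Real.rpow_one]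
      calc (n : ℝ) ^ (1 - β)
          = ((n + 1 : ℕ) : ℝ) ^ (1 - β) * (1 + -(1 / ((n + 1 : ℕ) : ℝ))) ^ (1 - β) := by
            rw [← Real.mul_rpow hn.le hpos, ← hsplit]
        _ ≤ ((n + 1 : ℕ) : ℝ) ^ (1 - β) * (1 + (1 - β) * -(1 / ((n + 1 : ℕ) : ℝ))) := by gcongr
        _ = _ := by rw [hone]; field_simp; ring
    calc _ ≤ (n : ℝ) ^ (1 - β) / (1 - β) + ((n + 1 : ℕ) : ℝ) ^ (-β) := by gcongr
      _ ≤ _ := by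
        rw [div_add' _ _ _ hβ'.ne', div_le_div_iff_of_pos_right hβ']
        linarith

/-- The gap of arm `i + 1` in a problem with `n + 1` arms. -/
noncomputable def gap (α : ℝ) (n i : ℕ) : ℝ := (((i + 1 : ℕ) : ℝ) / n) ^ α

variable {α : ℝ} {n i : ℕ}

theorem gap_pos (hi : i < n) : 0 < gap α n i := by
  have : 0 < n := by omega
  unfold gap; positivity

theorem gap_le_one (hα : 0 < α) (hi : i < n) : gap α n i ≤ 1 := by
  have h : (0 : ℝ) < n := by exact_mod_cast (by omega : 0 < n)
  refine Real.rpow_le_one (by positivity) ?_ hα.le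
  rw [div_le_one h]
  exact_mod_cast hi

/-- The contribution of arm `i + 1` to the complexity of the problem. -/
noncomputable def complexity (α : ℝ) (n i : ℕ) : ℝ :=
  (gap α n i ^ 2)⁻¹ * (1 + Real.log (gap α n i)⁻¹)

theorem one_le_complexity (hα : 0 < α) (hi : i < n) : 1 ≤ complexity α n i := by
  have h0 := gap_pos (α := α) hi
  have h1 := gap_le_one hα hi
  have h2 : 1 ≤ (gap α n i ^ 2)⁻¹ := (one_le_inv₀ (by positivity)).2 (pow_le_one₀ h0.le h1)
  have h3 : 0 ≤ Real.log (gap α n i)⁻¹ := Real.log_nonneg ((one_le_inv₀ h0).2 h1)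
  exact one_le_mul_of_one_le_of_one_le h2 (by linarith)

theorem complexity_eq (hi : i < n) : complexity α n i
    = (n / ((i + 1 : ℕ) : ℝ)) ^ (2 * α) * (1 + α * Real.log (n / ((i + 1 : ℕ) : ℝ))) := by
  have h : (0 : ℝ) < n := by exact_mod_cast (by omega : 0 < n)
  have hg : (gap α n i)⁻¹ = (n / ((i + 1 : ℕ) : ℝ)) ^ α := by
    rw [gap, ← Real.inv_rpow (by positivity), inv_div]
  rw [complexity, ← inv_pow, hg, Real.log_rpow (by positivity), mul_comm 2 α,
    Real.rpow_mul (by positivity), ← Real.rpow_natCast]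
  norm_num

/-- Replacing log(n/i) by log n is harmless for α ≥ 1/2, where the claimed rate has the logarithm
anyway; for α < 1/2 it would lose a factor. -/
theorem complexity_le_mul_log (hα : 0 < α) (hi : i < n) : complexity α n i
    ≤ (n : ℝ) ^ (2 * α) * (1 + α * Real.log n) * ((i + 1 : ℕ) : ℝ) ^ (-(2 * α)) := by
  have h : (0 : ℝ) < n := by exact_mod_cast (by omega : 0 < n)
  have hlog : Real.log (n / ((i + 1 : ℕ) : ℝ)) ≤ Real.log n := by
    refine Real.log_le_log (by positivity) (div_le_self h.le ?_)
    exact_mod_cast Nat.succ_pos i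
  rw [complexity_eq hi, Real.div_rpow h.le (by positivity), Real.rpow_neg (by positivity),
    mul_right_comm, ← div_eq_mul_inv]
  gcongr

theorem exists_sum_complexity_le (hα : 0 < α) :
    ∃ C : ℝ, ∀ n : ℕ, 2 ≤ n → ∑ i ∈ Finset.range n, complexity α n i ≤ C * rate α n := by
  have hl2 : 0 < Real.log 2 := Real.log_pos one_lt_two
  have hlog : ∀ {n : ℕ}, 2 ≤ n → Real.log 2 ≤ Real.log n := fun hn =>
    Real.log_le_log two_pos (by exact_mod_cast hn)
  have hone : ∀ {n : ℕ}, 2 ≤ n → 1 ≤ (Real.log 2)⁻¹ * Real.log n := fun hn => by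
    rw [← div_eq_inv_mul, le_div_iff₀ hl2, one_mul]; exact hlog hn
  rcases lt_trichotomy α (1 / 2) with hlt | heq | hgt
  -- The logarithm is absorbed into a power: log u ≤ u^γ / γ. With this γ the exponent 2α + γ = α +
  -- 1/2 stays below 1, so the sum is of order n.
  · set γ := 1 / 2 - α with hγ
    have hγ0 : 0 < γ := by linarith
    have hβ : 0 < 1 - (2 * α + γ) := by linarith
    refine ⟨(1 + α / γ) / (1 - (2 * α + γ)), fun n hn => ?_⟩
    rw [rate, if_pos hlt]
    have hn0 : (0 : ℝ) < n := by positivity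
    have hterm : ∀ i ∈ Finset.range n, complexity α n i
        ≤ (1 + α / γ) * (n : ℝ) ^ (2 * α + γ) * ((i + 1 : ℕ) : ℝ) ^ (-(2 * α + γ)) := by
      intro i hi
      rw [Finset.mem_range] at hi
      have hu : 1 ≤ n / ((i + 1 : ℕ) : ℝ) := by
        rw [one_le_div (by positivity)]; exact_mod_cast hi
      have h1 := Real.log_le_rpow_div (zero_le_one.trans hu) hγ0
      have h2 := Real.one_le_rpow hu hγ0.le
      rw [complexity_eq hi]
      calc _ ≤ (n / ((i + 1 : ℕ) : ℝ)) ^ (2 * α) * ((1 + α / γ) * (n / ((i + 1 : ℕ) : ℝ)) ^ γ) := by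
            gcongr
            calc _ ≤ (n / ((i + 1 : ℕ) : ℝ)) ^ γ + α * ((n / ((i + 1 : ℕ) : ℝ)) ^ γ / γ) := by
                  gcongr
              _ = _ := by ring
        _ = (1 + α / γ) * (n / ((i + 1 : ℕ) : ℝ)) ^ (2 * α + γ) := by
            rw [Real.rpow_add (by positivity)]; ring
        _ = _ := by
            rw [Real.div_rpow hn0.le (by positivity), Real.rpow_neg (by positivity)]; ring
    calc _ ≤ ∑ i ∈ Finset.range n,
          (1 + α / γ) * (n : ℝ) ^ (2 * α + γ) * ((i + 1 : ℕ) : ℝ) ^ (-(2 * α + γ)) :=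
          Finset.sum_le_sum hterm
      _ ≤ (1 + α / γ) * (n : ℝ) ^ (2 * α + γ)
          * ((n : ℝ) ^ (1 - (2 * α + γ)) / (1 - (2 * α + γ))) := by
          rw [← Finset.mul_sum]
          gcongr
          exact sum_range_rpow_neg_le (by positivity) (by linarith) n
      _ = (1 + α / γ) / (1 - (2 * α + γ))
          * ((n : ℝ) ^ (2 * α + γ) * (n : ℝ) ^ (1 - (2 * α + γ))) := by ring
      _ = _ := by rw [← Real.rpow_add hn0, add_sub_cancel, Real.rpow_one]
  -- At the critical exponent the harmonic sum supplies the second logarithm; constants are absorbed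
  -- through 1 ≤ log n / log 2.
  · refine ⟨((Real.log 2)⁻¹ + α) * ((Real.log 2)⁻¹ + 1), fun n hn => ?_⟩
    rw [rate, if_neg heq.not_lt, if_pos heq]
    have hL := hl2.le.trans (hlog hn)
    have h2α : 2 * α = 1 := by linarith
    have hharm : ∑ i ∈ Finset.range n, ((i + 1 : ℕ) : ℝ) ^ (-(2 * α)) ≤ 1 + Real.log n := by
      refine le_trans (le_of_eq ?_) (harmonic_le_one_add_log n)
      rw [harmonic, Rat.cast_sum]
      refine Finset.sum_congr rfl fun i _ => ?_
      rw [h2α, Real.rpow_neg_one]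
      push_cast
      rfl
    calc _ ≤ ∑ i ∈ Finset.range n,
          (n : ℝ) ^ (2 * α) * (1 + α * Real.log n) * ((i + 1 : ℕ) : ℝ) ^ (-(2 * α)) :=
          Finset.sum_le_sum fun i hi => complexity_le_mul_log hα (Finset.mem_range.1 hi)
      _ ≤ n * (((Real.log 2)⁻¹ * Real.log n) + α * Real.log n)
          * (((Real.log 2)⁻¹ * Real.log n) + Real.log n) := by
          rw [← Finset.mul_sum]
          conv_lhs => rw [h2α, Real.rpow_one]
          gcongr
          · exact hone hn
          · rw [← h2α]
            exact hharm.trans (by linarith [hone hn])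
      _ = _ := by ring
  -- Here 2α > 1, so the series of inverse powers converges and only the prefactor matters.
  · have hsum : Summable fun i : ℕ => ((i + 1 : ℕ) : ℝ) ^ (-(2 * α)) :=
      (summable_nat_add_iff 1).2 (Real.summable_nat_rpow.2 (by linarith))
    set Z := ∑' i : ℕ, ((i + 1 : ℕ) : ℝ) ^ (-(2 * α)) with hZ
    have hZ0 : 0 ≤ Z := tsum_nonneg fun i => by positivity
    refine ⟨((Real.log 2)⁻¹ + α) * Z, fun n hn => ?_⟩
    rw [rate, if_neg hgt.not_gt, if_neg hgt.ne']
    have hL := hl2.le.trans (hlog hn)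
    calc _ ≤ ∑ i ∈ Finset.range n,
          (n : ℝ) ^ (2 * α) * (1 + α * Real.log n) * ((i + 1 : ℕ) : ℝ) ^ (-(2 * α)) :=
          Finset.sum_le_sum fun i hi => complexity_le_mul_log hα (Finset.mem_range.1 hi)
      _ ≤ (n : ℝ) ^ (2 * α) * (((Real.log 2)⁻¹ * Real.log n) + α * Real.log n) * Z := by
          rw [← Finset.mul_sum]
          gcongr
          · exact hone hn
          · exact hsum.sum_le_tsum _ fun i _ => by positivity
      _ = _ := by ring

end Growth

-- Early and late samples for the polynomial gaps

section Complexity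

theorem alphaMean_zero_sub_succ {α : ℝ} {n : ℕ} (i : Fin n) :
    alphaMean α n 0 - alphaMean α n i.succ = gap α n i := by
  simp [alphaMean, gap]

theorem alphaMean_le {α : ℝ} {n : ℕ} (i : Fin (n + 1)) : alphaMean α n i ≤ alphaMean α n 0 := by
  refine Fin.cases le_rfl (fun i => ?_) i
  rw [← sub_nonneg, alphaMean_zero_sub_succ]
  exact (gap_pos i.2).le

theorem sum_erase_zero {M : Type*} [AddCommMonoid M] {n : ℕ} (f : Fin (n + 1) → M) :
    ∑ i ∈ Finset.univ.erase 0, f i = ∑ i : Fin n, f i.succ := by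
  rw [Fin.univ_succ, Finset.cons_eq_insert, Finset.erase_insert (by simp), Finset.sum_map]
  rfl

theorem one_le_failBound {δ : ℝ} (hδ : 1 / 2 ≤ δ) (hδ1 : δ < 1) : 1 ≤ failBound δ := by
  have h1 : 1 ≤ δ / (1 - δ) := by rw [one_le_div (by linarith)]; linarith
  have h2 : 0 < 1 - δ ^ 2 := by nlinarith
  have h3 : 0 ≤ 3 * δ ^ 2 / (1 - δ ^ 2) := by positivity
  have h4 : 0 ≤ 4 * δ ^ 2 / (1 - δ ^ 2) ^ 2 := by positivity
  unfold failBound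
  linarith

variable {α δ η : ℝ} {n : ℕ} {ν : Fin (n + 1) → Measure ℝ} {Ω : Type*} [MeasurableSpace Ω]
  {P : Measure Ω} [IsProbabilityMeasure P] {X : Slot (Fin (n + 1)) → Ω → ℝ}

/-- Markov's inequality for the samples taken after overestimations. -/
theorem IsSampling.measure_lateSamples_ge_le (h : IsSampling Slot.arm P ν X)
    (hν : ∀ i, ∀ᵐ t ∂(ν i), t ∈ Set.Icc (0 : ℝ) 1)
    (hμ : ∀ i, ∫ t, t ∂(ν i) = alphaMean α n i) (hδ : 0 < δ) (hδ2 : δ ≤ 1 / 2) (hη : 0 < η)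
    (hn : 0 < n) :
    P {ω | ENNReal.ofReal (6 * n / η) ≤ ∑ i : Fin n,
      lateSamples δ (alphaMean α n) i.succ (fun s => X s ω)} ≤ ENNReal.ofReal η := by
  have hm : Measurable fun ω => ∑ i : Fin n,
      lateSamples δ (alphaMean α n) i.succ (fun s => X s ω) :=
    Finset.measurable_sum _ fun i _ => h.measurable_lateSamples i.succ
  have hn' : (0 : ℝ) < n := by exact_mod_cast hn
  refine (meas_ge_le_lintegral_div hm.aemeasurable
    (ENNReal.ofReal_pos.2 (by positivity)).ne' ENNReal.ofReal_ne_top).trans ?_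
  refine ENNReal.div_le_of_le_mul ?_
  rw [lintegral_finsetSum _ fun i _ => h.measurable_lateSamples i.succ,
    ← ENNReal.ofReal_mul hη.le]
  calc _ ≤ ∑ i : Fin n, (6 : ℝ≥0∞) :=
        Finset.sum_le_sum fun i _ => h.lintegral_lateSamples_le hν hμ hδ hδ2 i.succ
    _ = ENNReal.ofReal (6 * n) := by
        rw [ENNReal.ofReal_mul (by norm_num)]
        simp [mul_comm]
    _ ≤ _ := ENNReal.ofReal_le_ofReal (by rw [mul_div_cancel₀ _ hη.ne'])

theorem sum_earlySamples_le (hα : 0 < α) (hδ : 0 < δ) (hδ1 : δ < 1) (n : ℕ) :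
    ∑ i : Fin n, earlySamples δ (gap α n i) ≤ ENNReal.ofReal (4 * (1 + 25 * Real.log (1 / δ))
      * (5 + 50 * Real.log (1 / δ)) * ∑ i ∈ Finset.range n, complexity α n i) := by
  have hL0 : 0 < Real.log (1 / δ) := Real.log_pos (one_lt_one_div hδ hδ1)
  rw [← Fin.sum_univ_eq_sum_range, Finset.mul_sum, ENNReal.ofReal_sum_of_nonneg fun i _ => ?_]
  · exact Finset.sum_le_sum fun i _ =>
      earlySamples_le hδ hδ1 (gap_pos i.2) (gap_le_one hα i.2)
  · exact mul_nonneg (by positivity) (zero_le_one.trans (one_le_complexity hα i.2))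

end Complexity

end Prism

theorem corollary1 (α δ : ℝ) (hα : 0 < α) (hδ0 : 0 < δ) (hδ1 : δ < 1) :
    ∃ C : ℝ, 0 < C ∧ ∀ n : ℕ, 2 ≤ n →
      ∀ (rule : Prism.HalvingRule (Fin (n + 1)))
        (ν : Fin (n + 1) → Measure ℝ) (_ : ∀ i, IsProbabilityMeasure (ν i))
        (_ : ∀ i, ∀ᵐ t ∂(ν i), t ∈ Set.Icc (0 : ℝ) 1)
        (_ : ∀ i, ∫ t, t ∂(ν i) = Prism.alphaMean α n i)
        (Ω : Type*) (_ : MeasurableSpace Ω) (P : Measure Ω) (_ : IsProbabilityMeasure P)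
        (X : Prism.Slot (Fin (n + 1)) → Ω → ℝ)
        (_ : Prism.IsSampling Prism.Slot.arm P ν X),
        1 - Prism.failBound δ ≤
          P.real {ω | Prism.samples rule δ (fun s => X s ω)
                ≤ ENNReal.ofReal (C * Prism.rate α n)
              ∧ Prism.Outputs rule δ (fun s => X s ω) 0} := by
  rcases le_or_gt (1 / 2) δ with hδ2 | hδ2
  · refine ⟨1, one_pos, fun n _ rule ν _ _ _ Ω _ P _ X _ => ?_⟩
    exact (sub_nonpos.2 (Prism.one_le_failBound hδ2 hδ1)).trans measureReal_nonneg
  obtain ⟨κ, hκ0, hκ⟩ := Prism.exists_meSamples_le hδ0 hδ1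
  obtain ⟨D, hD⟩ := Prism.exists_sum_complexity_le hα
  have hsq : 0 < 1 - δ ^ 2 := by nlinarith
  set η := 4 * δ ^ 2 / (1 - δ ^ 2) ^ 2 with hη
  have hη0 : 0 < η := by positivity
  have hL0 : 0 < Real.log (1 / δ) := Real.log_pos (one_lt_one_div hδ0 hδ1)
  set c := 4 * (1 + 25 * Real.log (1 / δ)) * (5 + 50 * Real.log (1 / δ)) with hc
  have hc0 : 0 < c := by positivity
  -- Each arm has complexity at least 1, so the Markov threshold 6n/η is also bounded by the target
  -- rate.
  have hn_le : ∀ n : ℕ, (n : ℝ) ≤ ∑ i ∈ Finset.range n, Prism.complexity α n i := fun n => by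
    calc (n : ℝ) = ∑ i ∈ Finset.range n, (1 : ℝ) := by simp
      _ ≤ _ := Finset.sum_le_sum fun i hi => Prism.one_le_complexity hα (Finset.mem_range.1 hi)
  -- Positivity is forced by the case n = 2, where the complexity sum is at least 2 and the rate is
  -- nonnegative.
  have hD0 : 0 < D := by
    by_contra hneg
    have h1 := (hn_le 2).trans (hD 2 le_rfl)
    have h2 : 0 ≤ Prism.rate α 2 := by
      unfold Prism.rate
      have := Real.log_pos one_lt_two
      split_ifs <;> push_cast <;> positivity
    have := mul_nonpos_of_nonpos_of_nonneg (not_lt.1 hneg) h2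
    norm_num at h1
    linarith
  refine ⟨2 * (κ + 1) * (c + 6 / η) * D, by positivity,
    fun n hn rule ν _ hν hμ Ω _ P _ X hX => ?_⟩
  have hle : ∑ i ∈ Finset.range n, Prism.complexity α n i ≤ D * Prism.rate α n := hD n hn
  set B₁ := {ω | ∃ j, Prism.PhaseBad rule δ (Prism.alphaMean α n) 0 (fun s => X s ω) j}
  set B₂ := {ω | ENNReal.ofReal (6 * n / η) ≤ ∑ i : Fin n,
    Prism.lateSamples δ (Prism.alphaMean α n) i.succ (fun s => X s ω)}
  set G := {ω | Prism.samples rule δ (fun s => X s ω)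
    ≤ ENNReal.ofReal (2 * (κ + 1) * (c + 6 / η) * D * Prism.rate α n)
      ∧ Prism.Outputs rule δ (fun s => X s ω) 0}
  -- Covering the whole space by the three events and using subadditivity of the outer measure
  -- avoids proving that `G` is measurable.
  have hcover : (Set.univ : Set Ω) ⊆ G ∪ (B₁ ∪ B₂) := by
    intro ω _
    by_contra hcon
    simp only [Set.mem_union, not_or] at hcon
    obtain ⟨hG, h1, h2⟩ := hcon
    refine hG ?_
    have hgood : ∀ j, ¬ Prism.PhaseBad rule δ (Prism.alphaMean α n) 0 (fun s => X s ω) j :=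
      fun j hj => h1 ⟨j, hj⟩
    have hlate : ∑ i : Fin n, Prism.lateSamples δ (Prism.alphaMean α n) i.succ (fun s => X s ω)
        ≤ ENNReal.ofReal (6 * n / η) := le_of_lt (not_le.1 h2)
    have hsamples : Prism.samples rule δ (fun s => X s ω)
        ≤ ENNReal.ofReal (2 * (κ + 1) * (c + 6 / η) * D * Prism.rate α n) := by
      refine (Prism.samples_le Prism.alphaMean_le hgood
        (fun l hl S y => hκ rule hl S y)).trans ?_
      rw [Prism.sum_erase_zero, Finset.sum_add_distrib]
      simp only [Prism.alphaMean_zero_sub_succ]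
      have hS : 0 ≤ ∑ i ∈ Finset.range n, Prism.complexity α n i := n.cast_nonneg.trans (hn_le n)
      calc _ ≤ 2 * (ENNReal.ofReal κ + 1)
            * (ENNReal.ofReal (c * ∑ i ∈ Finset.range n, Prism.complexity α n i)
              + ENNReal.ofReal (6 * n / η)) := by
            gcongr
            exact Prism.sum_earlySamples_le hα hδ0 hδ1 n
        _ = ENNReal.ofReal (2 * (κ + 1)
            * (c * ∑ i ∈ Finset.range n, Prism.complexity α n i + 6 * n / η)) := by
            rw [ENNReal.ofReal_mul (p := 2 * (κ + 1)) (by positivity),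
              ENNReal.ofReal_mul (p := 2) (by positivity), ENNReal.ofReal_add hκ0 zero_le_one, ENNReal.ofReal_add (by positivity)
              (by positivity), ENNReal.ofReal_one, ENNReal.ofReal_ofNat]
        _ ≤ _ := by
            refine ENNReal.ofReal_le_ofReal ?_
            calc _ ≤ 2 * (κ + 1) * (c * (D * Prism.rate α n) + 6 * (D * Prism.rate α n) / η) := by
                  gcongr
                  exact (hn_le n).trans hle
              _ = _ := by ring
    exact ⟨hsamples, Prism.outputs_of_samples_ne_top
      (fun j => Prism.mem_active_of_not_phaseBad Prism.alphaMean_le hgood j)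
      (ne_top_of_le_ne_top ENNReal.ofReal_ne_top hsamples)⟩
  have hB₁ : P B₁ ≤ ENNReal.ofReal (3 * δ ^ 2 / (1 - δ ^ 2) + δ / (1 - δ)) :=
    hX.measure_exists_phaseBad_le rule hν hμ hδ0 hδ1 0
  have hB₂ : P B₂ ≤ ENNReal.ofReal η :=
    hX.measure_lateSamples_ge_le hν hμ hδ0 hδ2.le hη0 (by omega)
  have hδ' : 0 < 1 - δ := by linarith
  have h1 : P.real B₁ ≤ 3 * δ ^ 2 / (1 - δ ^ 2) + δ / (1 - δ) :=
    ENNReal.toReal_le_of_le_ofReal (by positivity) hB₁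
  have h2 : P.real B₂ ≤ η := ENNReal.toReal_le_of_le_ofReal hη0.le hB₂
  have h3 : 1 ≤ P.real G + (P.real B₁ + P.real B₂) := by
    calc 1 = P.real Set.univ := by simp
      _ ≤ P.real (G ∪ (B₁ ∪ B₂)) := measureReal_mono hcover
      _ ≤ P.real G + P.real (B₁ ∪ B₂) := measureReal_union_le _ _
      _ ≤ _ := by gcongr; exact measureReal_union_le _ _
  unfold Prism.failBound
  linarith
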